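/- Consider a single-hop beeping network of $n\ge 1$ nodes. All nodes share a global clock and start together; in each time slot every node that has not terminated either transmits a beep, listens, or sleeps. A listening node learns whether at least one node beeps in that slot; a transmitting or sleeping node learns nothing. A node is awake in a slot if it transmits or listens. The nodes are initially indistinguishable and do not know $n$: they have no identifiers and no input, and all execute the same randomized algorithm, which does not depend on $n$, each with its own independent fair coin flips and unbounded local computation. There exist a randomized algorithm and constants $c,K,L>0$ such that for every $n\ge 1$, when the algorithm is executed on the single-hop beeping network of $n$ nodes, with probability at least $1-n^{-c}$ the following holds: all nodes terminate within $K\,n\log n$ time slots, each of them with the exact value of $n$ as its output, and no node is awake in more than $L\log^2 n$ time slots during the whole execution. -/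

import Mathlib

open MeasureTheory

/-- The private randomness of a node: an infinite sequence of bits. -/
abbrev CoinTape : Type := ℕ → Bool

/-- The law of one tape: independent fair coin flips. -/
noncomputable def coinTapeMeasure : Measure CoinTape :=
  Measure.infinitePi fun _ : ℕ => (PMF.uniformOfFintype Bool).toMeasure

instance coinTapeMeasure_isProbabilityMeasure : IsProbabilityMeasure coinTapeMeasure := by
  unfold coinTapeMeasure
  infer_instance

/-- The joint law of the tapes of `n` nodes: the tapes are independent and identically
distributed. -/
noncomputable def networkMeasure (n : ℕ) : Measure (Fin n → CoinTape) :=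
  Measure.pi fun _ => coinTapeMeasure

/-- What a node does next: transmit a beep, listen to the channel, or sleep during the current time
slot, or stop for good with a natural number as its output. -/
inductive BeepDecision : Type
  | beep
  | listen
  | sleep
  | halt (output : ℕ)

/-- What a node perceives in a time slot: a beep or silence if it listens, and nothing at all if it
transmits or sleeps. -/
inductive BeepPerception : Type
  | beep
  | silence
  | nothing

namespace BeepDecision

/-- The node transmits. -/
def isBeep : BeepDecision → Bool
  | beep => true
  | _ => false

/-- The node is awake (active): it transmits or it listens. -/
def isAwake : BeepDecision → Bool
  | beep => true
  | listen => true
  | _ => false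

/-- The local history (most recent slot first) after one more time slot, where `busy` tells whether
at least one node transmits in that slot. A node that has halted takes no further part, so that its
history, and with it its decision, never changes again. -/
def extendHistory (busy : Bool) : BeepDecision → List BeepPerception → List BeepPerception
  | beep, h => BeepPerception.nothing :: h
  | listen, h => (if busy then BeepPerception.beep else BeepPerception.silence) :: h
  | sleep, h => BeepPerception.nothing :: h
  | halt _, h => h

end BeepDecision

/-- A randomized algorithm for the beeping model, as executed by a single node. The node has no
identifier and no input: its decision for the next time slot depends only on its own coin flips and
on what it has perceived so far (which includes the number of slots elapsed, i.e. the global clock).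
Local computation is unbounded; the decisions are random variables. -/
structure BeepAlgorithm : Type where
  /-- The next decision, given the coin flips and the local history, most recent slot first. -/
  next : CoinTape → List BeepPerception → BeepDecision
  measurableSet_next : ∀ (h : List BeepPerception) (d : BeepDecision),
    MeasurableSet {τ : CoinTape | next τ h = d}

namespace BeepAlgorithm

variable (A : BeepAlgorithm) {n : ℕ} (ω : Fin n → CoinTape)

/-- The local histories of all nodes after the first `t` time slots of the execution of `A` on the
single-hop network (complete graph) of the `n` nodes of `Fin n`, with coin flips `ω`. All nodes
execute the same algorithm and start at the same time. -/
def history : ℕ → Fin n → List BeepPerception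
  | 0 => fun _ => []
  | t + 1 => fun v =>
      BeepDecision.extendHistory (decide (∃ w, (A.next (ω w) (history t w)).isBeep = true))
        (A.next (ω v) (history t v)) (history t v)

/-- The decision of node `v` for time slot `t` (slots are numbered from `0`). -/
def decision (t : ℕ) (v : Fin n) : BeepDecision :=
  A.next (ω v) (A.history ω t v)

/-- The number of time slots among the first `t` ones in which node `v` is awake. -/
def energy (t : ℕ) (v : Fin n) : ℕ :=
  ((Finset.range t).filter fun s => (A.decision ω s v).isAwake = true).card

/-- In the execution with coin flips `ω`, after at most `T` time slots all nodes have terminated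
with the exact number `n` of nodes as their output, and no node is ever awake in more than `E` time
slots of the execution. -/
def CountsWithin (T E : ℝ) : Prop :=
  (∃ t : ℕ, (t : ℝ) ≤ T ∧ ∀ v, A.decision ω t v = BeepDecision.halt n) ∧
    ∀ (t : ℕ) (v : Fin n), (A.energy ω t v : ℝ) ≤ E

end BeepAlgorithm

/-! The protocol guesses `n` up to a constant factor, splits the nodes into small random buckets and
counts these one after the other, passing a running total along.

Estimation: in phase `j` every node beeps with probability `2 ^ (-j)` in each of `8 * j` slots. If
`n ≥ 4 * 2 ^ j`, most slots are busy; if `16 * n ≤ 2 ^ j`, most are silent (`network_many_silent`,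
`network_many_busy`). The first mostly silent phase `k` thus satisfies `n < 4 * 2 ^ k`, and `2 ^ k <
32 * n` unless `k = 20`. All nodes stay awake, but only for `O(k ^ 2)` slots.

Counting: there are about `2 ^ k / k` buckets, each likely to be nonempty and to hold `O(k)` nodes.
The members of a bucket list their distinct identifiers in decreasing order, each found by binary
search on the question whether some identifier lies in an interval, which one slot answers
(`exec_searches`). They add their number to the running total and beep its binary digits to the next
bucket (`exec_send`). A window has `O(k ^ 2)` slots, so the total time is `O(k * 2 ^ k)`. A node is
awake only in its own window, the preceding one and the last one, where all learn `n`
(`exec_count`).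

Each failure is controlled by a union bound over events that are products over the nodes. Phases,
buckets and identifiers may therefore reuse the same bits: no independence between them is needed.
Starting at phase 20 makes the failure probability `O(1 / max n (2 ^ 20))`, so that the constant is
absorbed by taking `c = 1 / 2`; it also gives exactly one bucket for `k = 20`. -/

namespace Counting

/-- The first phase of the size estimation. -/
def firstPhase : ℕ := 20

/-- The binary logarithm of the number of buckets used with the size estimate `2 ^ k`. -/
def bucketBits (k : ℕ) : ℕ := k - (Nat.log 2 k + 16)

/-- The largest bucket size that the protocol can handle with the size estimate `2 ^ k`. -/
def maxLoad (k : ℕ) : ℕ := 2 ^ 21 * k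

/-- A number of bits large enough for all identifiers. -/
def idBits (k : ℕ) : ℕ := 4 * k + 1

/-- A number of bits large enough for the number of nodes. -/
def sizeBits (k : ℕ) : ℕ := k + 2

/-- The number whose binary digits are the first `m` bits of the tape. -/
def prefixVal (m : ℕ) (τ : CoinTape) : ℕ := ∑ r ∈ Finset.range m, if τ r then 2 ^ r else 0

/-- The random bucket of a node. -/
def bucket (k : ℕ) (τ : CoinTape) : ℕ := prefixVal (bucketBits k) τ

/-- The random identifier of a node. -/
def ident (k : ℕ) (τ : CoinTape) : ℕ := prefixVal (4 * k) τ + 1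

/-- The event of probability `2 ^ (-j)` in which a node beeps in slot `i` of phase `j`. -/
def blockTrue (j i : ℕ) (τ : CoinTape) : Prop := ∀ r < j, τ (i * j + r) = true

instance (j i : ℕ) (τ : CoinTape) : Decidable (blockTrue j i τ) :=
  inferInstanceAs (Decidable (∀ r < j, τ (i * j + r) = true))

/-- The local state of a node. -/
inductive NodeState : Type
  /-- Estimation phase `j`: `s` silent slots so far, `i` slots to go. -/
  | estimate (j s i : ℕ)
  /-- The nodes of bucket `w` count themselves: `e` iterations to go, `cnt` nodes found, all of them
  with identifiers at least `u`; in the present binary search for the largest identifier below `u`,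
  `lo` is the current lower bound and `s` bits are left. `acc` is the number of nodes in earlier
  buckets. -/
  | search (k w acc e cnt u lo s : ℕ)
  /-- The nodes of bucket `w` transmit the number `v`, of which `x` has been received so far and `r`
  bits are left. -/
  | send (k w v x r : ℕ)
  | done (x : ℕ)
  deriving Countable

namespace NodeState

/-- The state at the beginning of phase `j` of the estimation. -/
def startPhase (j : ℕ) : NodeState := estimate j 0 (8 * j)

/-- The state at the beginning of window `w`. -/
def startWindow (k w acc : ℕ) : NodeState :=
  search k w acc (maxLoad k) 0 (2 ^ idBits k) 0 (idBits k)

/-- The state at the end of window `w`, after receiving `x`. -/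
def finishWindow (k w x : ℕ) : NodeState :=
  if w + 1 = 2 ^ bucketBits k then done x else startWindow k (w + 1) x

/-- The next state, given whether the node knows of a beep in the present slot. -/
def update : NodeState → Bool → NodeState
  | estimate j s (i + 1), b => estimate j (if b then s else s + 1) i
  | estimate j s 0, _ => if 4 * j ≤ s then startWindow j 0 0 else startPhase (j + 1)
  | search k w acc e cnt u lo (s + 1), b => search k w acc e cnt u (if b then lo + 2 ^ s else lo) s
  | search k w acc (e + 1) cnt _ lo 0, _ =>
      search k w acc e (if lo = 0 then cnt else cnt + 1) lo 0 (idBits k)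
  | search k w acc 0 cnt _ _ 0, _ => send k w (acc + cnt) 0 (sizeBits k)
  | send k w v x (r + 1), b => send k w v (2 * x + b.toNat) r
  | send k w _ x 0, _ => finishWindow k w x
  | done x, _ => done x

/-- The decision of a node. -/
def act (τ : CoinTape) : NodeState → BeepDecision
  | estimate j _ (i + 1) => if blockTrue j i τ then .beep else .listen
  | estimate _ _ 0 => .sleep
  | search k w _ _ _ u lo (s + 1) =>
      if bucket k τ = w then
        if lo + 2 ^ s ≤ ident k τ ∧ ident k τ < u then .beep else .listen
      else .sleep
  | search _ _ _ _ _ _ _ 0 => .sleep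
  | send k w v _ (r + 1) =>
      if bucket k τ = w then if v.testBit r then .beep else .listen
      else if bucket k τ = w + 1 ∨ w + 1 = 2 ^ bucketBits k then .listen else .sleep
  | send _ _ _ _ 0 => .sleep
  | done x => .halt x

instance : MeasurableSpace NodeState := ⊤

instance : DiscreteMeasurableSpace NodeState := ⟨fun _ => trivial⟩

end NodeState

open NodeState

instance : MeasurableSpace BeepDecision := ⊤

instance : DiscreteMeasurableSpace BeepDecision := ⟨fun _ => trivial⟩

/-! ### Measurability of the decisions -/

theorem measurable_prefixVal (m : ℕ) : Measurable (prefixVal m) := by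
  refine Finset.measurable_sum _ fun r _ => ?_
  refine Measurable.ite ?_ measurable_const measurable_const
  exact measurableSet_eq_fun (measurable_pi_apply r) measurable_const

theorem measurableSet_blockTrue (j i : ℕ) : MeasurableSet {τ | blockTrue j i τ} := by
  have : {τ | blockTrue j i τ} = ⋂ r ∈ Finset.range j, (fun τ : CoinTape => τ (i * j + r)) ⁻¹' {true} := by
    ext τ
    simp [blockTrue]
  rw [this]
  exact Finset.measurableSet_biInter _ fun r _ =>
    measurable_pi_apply _ (measurableSet_singleton true)

theorem measurable_act (s : NodeState) : Measurable fun τ => act τ s := by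
  have hb : ∀ k, Measurable (bucket k) := fun k => measurable_prefixVal _
  have hi : ∀ k, Measurable (ident k) := fun k => (measurable_prefixVal _).add_const 1
  rcases s with ⟨j, s, _ | i⟩ | ⟨k, w, acc, e, cnt, u, lo, _ | s⟩ | ⟨k, w, v, x, _ | r⟩ | x
  · exact measurable_const
  · exact Measurable.ite (measurableSet_blockTrue j i) measurable_const measurable_const
  · exact measurable_const
  · refine Measurable.ite (hb k (measurableSet_singleton w)) (Measurable.ite ?_ measurable_const
      measurable_const) measurable_const
    exact hi k (MeasurableSet.of_discrete (s := {x | lo + 2 ^ s ≤ x ∧ x < u}))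
  · exact measurable_const
  · refine Measurable.ite (hb k (measurableSet_singleton w)) measurable_const
      (Measurable.ite ?_ measurable_const measurable_const)
    exact hb k (MeasurableSet.of_discrete (s := {x | x = w + 1 ∨ w + 1 = 2 ^ bucketBits k}))
  · exact measurable_const

/-- Whether a beep has been perceived. -/
def heard : BeepPerception → Bool
  | .beep => true
  | _ => false

/-- The local state of a node with the given history. -/
def localState (τ : CoinTape) : List BeepPerception → NodeState
  | [] => startPhase firstPhase
  | p :: h => update (localState τ h) (heard p || (act τ (localState τ h)).isBeep)

/-- There are only countably many states, so measurability in the tape for each fixed state gives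
joint measurability. -/
theorem measurable_act_comp {f : CoinTape → NodeState} (hf : Measurable f) :
    Measurable fun τ => act τ (f τ) := by
  have h : Measurable fun p : NodeState × CoinTape => act p.2 p.1 :=
    measurable_from_prod_countable_right measurable_act
  exact h.comp (hf.prodMk measurable_id)

theorem measurable_localState (h : List BeepPerception) : Measurable fun τ => localState τ h := by
  induction h with
  | nil => exact measurable_const
  | cons p h ih =>
    have h2 := measurable_act_comp ih
    have h3 : Measurable fun q : NodeState × BeepDecision => update q.1 (heard p || q.2.isBeep) :=
      measurable_from_prod_countable_right fun s => measurable_from_top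
    exact h3.comp (ih.prodMk h2)

/-- The counting algorithm. -/
def algorithm : BeepAlgorithm where
  next τ h := act τ (localState τ h)
  measurableSet_next h d :=
    measurable_act_comp (measurable_localState h) (measurableSet_singleton d)

/-! ### Executions as iterations of a map on configurations -/

variable {n : ℕ} (ω : Fin n → CoinTape)

/-- Whether some node transmits in the configuration `C`. -/
def busy (C : Fin n → NodeState) : Bool := decide (∃ w, (act (ω w) (C w)).isBeep = true)

/-- The configuration one time slot after `C`. -/
def stepConfig (C : Fin n → NodeState) : Fin n → NodeState := fun v =>
  update (C v) ((act (ω v) (C v)).isAwake && busy ω C)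

/-- The history of a halted node is frozen while `stepConfig` keeps updating its state; the two
agree because a halting state is a fixed point. -/
theorem update_of_act_eq_halt {τ : CoinTape} {s : NodeState} {x : ℕ} {b : Bool}
    (h : act τ s = .halt x) : update s b = s := by
  rcases s with ⟨j, s, _ | i⟩ | ⟨k, w, acc, e, cnt, u, lo, _ | s⟩ | ⟨k, w, v, x, _ | r⟩ | x <;>
    simp only [act] at h <;> (try split_ifs at h) <;> first | rfl | simp at h

/-- Replaces histories by states, so that the rest of the analysis only iterates `stepConfig`. -/
theorem localState_history (t : ℕ) :
    (fun v => localState (ω v) (algorithm.history ω t v)) =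
      (stepConfig ω)^[t] fun _ => startPhase firstPhase := by
  induction t with
  | zero => rfl
  | succ t ih =>
    rw [Function.iterate_succ_apply', ← ih]
    funext v
    simp only [BeepAlgorithm.history, stepConfig]
    have hb : decide (∃ w, (algorithm.next (ω w) (algorithm.history ω t w)).isBeep = true) =
        busy ω (fun v => localState (ω v) (algorithm.history ω t v)) := rfl
    rw [hb]
    have hn : algorithm.next (ω v) (algorithm.history ω t v) =
      act (ω v) (localState (ω v) (algorithm.history ω t v)) := rfl
    rw [hn]
    -- A transmitter perceives nothing, but its own beep makes the channel busy. Hence the bit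
    -- computed in `localState` is the one used in `stepConfig`.
    have hbusy : (act (ω v) (localState (ω v) (algorithm.history ω t v))).isBeep = true →
        busy ω (fun v => localState (ω v) (algorithm.history ω t v)) = true :=
      fun h => decide_eq_true ⟨v, h⟩
    generalize busy ω (fun v => localState (ω v) (algorithm.history ω t v)) = b at *
    cases hd : act (ω v) (localState (ω v) (algorithm.history ω t v)) with
    | beep =>
      rw [hd] at hbusy
      simp [BeepDecision.extendHistory, localState, hd, BeepDecision.isBeep, heard,
        BeepDecision.isAwake, hbusy rfl]
    | listen =>
      cases b <;> simp [BeepDecision.extendHistory, localState, hd, BeepDecision.isBeep, heard,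
        BeepDecision.isAwake]
    | sleep =>
      simp [BeepDecision.extendHistory, localState, hd, BeepDecision.isBeep, heard,
        BeepDecision.isAwake]
    | halt x =>
      simp only [BeepDecision.extendHistory]
      rw [update_of_act_eq_halt hd]

theorem decision_eq (t : ℕ) (v : Fin n) :
    algorithm.decision ω t v =
      act (ω v) ((stepConfig ω)^[t] (fun _ => startPhase firstPhase) v) := by
  rw [← localState_history]
  rfl

/-- The number of time slots in which node `v` is awake among the first `t` ones starting from the
configuration `C`. -/
def awakeCount (t : ℕ) (C : Fin n → NodeState) (v : Fin n) : ℕ :=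
  ∑ s ∈ Finset.range t, (act (ω v) ((stepConfig ω)^[s] C v)).isAwake.toNat

theorem energy_eq (t : ℕ) (v : Fin n) :
    algorithm.energy ω t v = awakeCount ω t (fun _ => startPhase firstPhase) v := by
  rw [BeepAlgorithm.energy, awakeCount, Finset.card_filter]
  refine Finset.sum_congr rfl fun s _ => ?_
  rw [decision_eq]
  cases (act (ω v) ((stepConfig ω)^[s] (fun _ => startPhase firstPhase) v)).isAwake <;> rfl

theorem awakeCount_add (t t' : ℕ) (C : Fin n → NodeState) (v : Fin n) :
    awakeCount ω (t + t') C v = awakeCount ω t C v + awakeCount ω t' ((stepConfig ω)^[t] C) v := by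
  simp only [awakeCount]
  rw [Finset.sum_range_add]
  simp only [Nat.add_comm t, Function.iterate_add_apply]

/-- The execution leads from the configuration `C` to `C'` in `t` time slots, during which each node
`v` is awake in at most `e v` slots. -/
structure Exec (t : ℕ) (e : Fin n → ℕ) (C C' : Fin n → NodeState) : Prop where
  iterate_eq : (stepConfig ω)^[t] C = C'
  awakeCount_le : ∀ v, awakeCount ω t C v ≤ e v

variable {ω}

theorem Exec.refl (C : Fin n → NodeState) : Exec ω 0 0 C C := ⟨rfl, fun _ => le_rfl⟩

theorem Exec.trans {t t' : ℕ} {e e' : Fin n → ℕ} {C C' C'' : Fin n → NodeState}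
    (h : Exec ω t e C C') (h' : Exec ω t' e' C' C'') : Exec ω (t + t') (e + e') C C'' := by
  refine ⟨?_, fun v => ?_⟩
  · rw [Nat.add_comm, Function.iterate_add_apply, h.iterate_eq, h'.iterate_eq]
  · rw [awakeCount_add, h.iterate_eq]
    exact Nat.add_le_add (h.awakeCount_le v) (h'.awakeCount_le v)

theorem Exec.mono {t : ℕ} {e e' : Fin n → ℕ} {C C' : Fin n → NodeState}
    (h : Exec ω t e C C') (he : ∀ v, e v ≤ e' v) : Exec ω t e' C C' :=
  ⟨h.iterate_eq, fun v => (h.awakeCount_le v).trans (he v)⟩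

theorem Exec.single {e : Fin n → ℕ} {C C' : Fin n → NodeState}
    (hC : ∀ v, update (C v) ((act (ω v) (C v)).isAwake && busy ω C) = C' v)
    (he : ∀ v, (act (ω v) (C v)).isAwake.toNat ≤ e v) : Exec ω 1 e C C' := by
  refine ⟨funext hC, fun v => ?_⟩
  simpa [awakeCount] using he v

/-- Once all nodes have stopped, the configuration does not change any more and no node is awake. -/
theorem awakeCount_done (t x : ℕ) (v : Fin n) :
    (stepConfig ω)^[t] (fun _ => done x) = (fun _ => done x) ∧
      awakeCount ω t (fun _ => done x) v = 0 := by
  have h : ∀ t, (stepConfig ω)^[t] (fun _ => done x) = (fun _ => done x) := by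
    intro t
    induction t with
    | zero => rfl
    | succ t ih => rw [Function.iterate_succ_apply', ih]; rfl
  refine ⟨h t, ?_⟩
  rw [awakeCount]
  refine Finset.sum_eq_zero fun s _ => ?_
  rw [h s]
  rfl

/-- An execution that leads to termination with the correct output gives a correct count. -/
theorem Exec.countsWithin {t E : ℕ} {T E' : ℝ}
    (h : Exec ω t (fun _ => E) (fun _ => startPhase firstPhase) (fun _ => done n))
    (hT : (t : ℝ) ≤ T) (hE : (E : ℝ) ≤ E') : algorithm.CountsWithin ω T E' := by
  refine ⟨⟨t, hT, fun v => ?_⟩, fun s v => ?_⟩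
  · rw [decision_eq, h.iterate_eq]
    rfl
  · refine le_trans ?_ hE
    rw [energy_eq]
    -- Splitting `s + t` slots in both orders bounds the energy at an arbitrary time `s` by the
    -- energy at the time `t` of termination, after which nobody is awake.
    have h1 := awakeCount_add ω s t (fun _ => startPhase firstPhase) v
    have h2 := awakeCount_add ω t s (fun _ => startPhase firstPhase) v
    rw [h.iterate_eq, (awakeCount_done s n v).2] at h2
    rw [Nat.add_comm s t] at h1
    have h3 := h.awakeCount_le v
    exact_mod_cast (by omega)

theorem busy_eq_decide {C : Fin n → NodeState} {p : Prop} [Decidable p]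
    (h : (∃ w, (act (ω w) (C w)).isBeep = true) ↔ p) : busy ω C = decide p := by
  simp [busy, h]

/-! ### Ranges of the random labels -/

theorem prefixVal_lt (m : ℕ) (τ : CoinTape) : prefixVal m τ < 2 ^ m := by
  induction m with
  | zero => simp [prefixVal]
  | succ m ih =>
    rw [prefixVal, Finset.sum_range_succ, pow_succ]
    rw [prefixVal] at ih
    split_ifs <;> omega

theorem bucket_lt (k : ℕ) (τ : CoinTape) : bucket k τ < 2 ^ bucketBits k := prefixVal_lt _ _

theorem ident_pos (k : ℕ) (τ : CoinTape) : 0 < ident k τ := Nat.succ_pos _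

theorem ident_lt (k : ℕ) (τ : CoinTape) : ident k τ < 2 ^ idBits k := by
  have h := prefixVal_lt (4 * k) τ
  have h1 := Nat.one_le_two_pow (n := 4 * k)
  rw [ident, idBits, pow_succ]
  omega

/-! ### Estimation -/

variable (ω) in
/-- The number of silent slots among the first `i` ones of phase `j`. -/
def silentCount (j i : ℕ) : ℕ :=
  ((Finset.range i).filter fun i => ∀ v, ¬ blockTrue j i (ω v)).card

/-- Every node is awake in every slot, so all of them learn the same bit and their states remain
equal. -/
theorem exec_estimate (j s i : ℕ) :
    Exec ω i (fun _ => i) (fun _ => estimate j s i)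
      (fun _ => estimate j (s + silentCount ω j i) 0) := by
  induction i generalizing s with
  | zero => exact (Exec.refl _)
  | succ i ih =>
    have hb : busy ω (fun _ => estimate j s (i + 1)) = decide (∃ v, blockTrue j i (ω v)) := by
      refine busy_eq_decide (exists_congr fun v => ?_)
      by_cases h : blockTrue j i (ω v) <;> simp [act, h, BeepDecision.isBeep]
    have h1 : Exec ω 1 (fun _ => 1) (fun _ => estimate j s (i + 1))
        (fun _ => estimate j (if ∃ v, blockTrue j i (ω v) then s else s + 1) i) := by
      refine Exec.single (fun v => ?_) fun v => Bool.toNat_le _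
      have ha : (act (ω v) (estimate j s (i + 1))).isAwake = true := by
        simp only [act]
        split_ifs <;> rfl
      rw [ha, hb]
      simp [update]
    have h2 := h1.trans (ih (if ∃ v, blockTrue j i (ω v) then s else s + 1))
    rw [Nat.add_comm 1 i] at h2
    have h3 : (if ∃ v, blockTrue j i (ω v) then s else s + 1) + silentCount ω j i =
        s + silentCount ω j (i + 1) := by
      simp only [silentCount, Finset.range_add_one, Finset.filter_insert]
      by_cases h : ∃ v, blockTrue j i (ω v)
      · rw [if_pos h, if_neg (by push Not; exact h)]
      · rw [if_neg h, if_pos (by push Not at h; exact h), Finset.card_insert_of_notMem (by simp)]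
        omega
    rw [h3] at h2
    exact h2.mono fun v => (Nat.add_comm 1 i).le

/-- One phase of the estimation. -/
theorem exec_phase (j : ℕ) :
    Exec ω (8 * j + 1) (fun _ => 8 * j + 1) (fun _ => startPhase j)
      (fun _ => if 4 * j ≤ silentCount ω j (8 * j) then startWindow j 0 0 else startPhase (j + 1)) := by
  have h := exec_estimate (ω := ω) j 0 (8 * j)
  rw [Nat.zero_add] at h
  refine h.trans (e' := fun _ => 1) (Exec.single (fun v => rfl) fun v => Bool.toNat_le _)

theorem exec_phases {k : ℕ} (hk : firstPhase ≤ k)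
    (h : ∀ j, firstPhase ≤ j → j < k → silentCount ω j (8 * j) < 4 * j) :
    ∃ t ≤ k * (8 * k + 1),
      Exec ω t (fun _ => t) (fun _ => startPhase firstPhase) (fun _ => startPhase k) := by
  induction k, hk using Nat.le_induction with
  | base => exact ⟨0, Nat.zero_le _, Exec.refl _⟩
  | succ k hk ih =>
    obtain ⟨t, ht, h1⟩ := ih fun j hj hjk => h j hj (by omega)
    have h2 := h1.trans (exec_phase k)
    simp only [if_neg (not_le.2 (h k hk k.lt_succ_self))] at h2
    refine ⟨_, ?_, h2⟩
    calc t + (8 * k + 1) ≤ k * (8 * k + 1) + (8 * k + 1) := by omega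
      _ = (k + 1) * (8 * k + 1) := by ring
      _ ≤ (k + 1) * (8 * (k + 1) + 1) := Nat.mul_le_mul_left _ (by omega)

theorem exec_estimation {k : ℕ} (hk : firstPhase ≤ k)
    (h : ∀ j, firstPhase ≤ j → j < k → silentCount ω j (8 * j) < 4 * j)
    (hs : 4 * k ≤ silentCount ω k (8 * k)) :
    ∃ t ≤ (k + 1) * (8 * k + 1),
      Exec ω t (fun _ => t) (fun _ => startPhase firstPhase) (fun _ => startWindow k 0 0) := by
  obtain ⟨t, ht, h1⟩ := exec_phases hk h
  have h2 := h1.trans (exec_phase k)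
  simp only [if_pos hs] at h2
  exact ⟨_, by rw [Nat.add_mul, Nat.one_mul]; omega, h2⟩

/-! ### Counting the nodes of a bucket -/

variable (ω) in
/-- The nodes of bucket `w`. -/
def members (k w : ℕ) : Finset (Fin n) := Finset.univ.filter fun v => bucket k (ω v) = w

variable (ω) in
/-- The largest identifier below `u` in bucket `w`, or `0` if there is none. -/
def maxBelow (k w u : ℕ) : ℕ :=
  ((members ω k w).filter fun v => ident k (ω v) < u).sup fun v => ident k (ω v)

theorem mem_members {k w : ℕ} {v : Fin n} : v ∈ members ω k w ↔ bucket k (ω v) = w := by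
  simp [members]

theorem le_maxBelow {k w u : ℕ} {v : Fin n} (hv : v ∈ members ω k w) (hu : ident k (ω v) < u) :
    ident k (ω v) ≤ maxBelow ω k w u :=
  Finset.le_sup (f := fun v => ident k (ω v)) (Finset.mem_filter.2 ⟨hv, hu⟩)

theorem exists_eq_maxBelow {k w u : ℕ} (h : 0 < maxBelow ω k w u) :
    ∃ v ∈ members ω k w, ident k (ω v) < u ∧ ident k (ω v) = maxBelow ω k w u := by
  have hne : ((members ω k w).filter fun v => ident k (ω v) < u).Nonempty := by
    by_contra hne
    rw [Finset.not_nonempty_iff_eq_empty] at hne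
    simp [maxBelow, hne] at h
  obtain ⟨v, hv, he⟩ := Finset.exists_mem_eq_sup _ hne fun v => ident k (ω v)
  rw [Finset.mem_filter] at hv
  exact ⟨v, hv.1, hv.2, he.symm⟩

/-- The left side is what one slot of the binary search tests. Positivity of `l` excludes the
default value `0` of `maxBelow`. -/
theorem exists_ident_iff {k w u l : ℕ} (hl : 0 < l) :
    (∃ v ∈ members ω k w, l ≤ ident k (ω v) ∧ ident k (ω v) < u) ↔ l ≤ maxBelow ω k w u := by
  constructor
  · rintro ⟨v, hv, h1, h2⟩
    exact h1.trans (le_maxBelow hv h2)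
  · intro h
    obtain ⟨v, hv, h1, h2⟩ := exists_eq_maxBelow (hl.trans_le h)
    exact ⟨v, hv, h2 ▸ h, h1⟩

theorem maxBelow_lt (k w u : ℕ) : maxBelow ω k w u < 2 ^ idBits k := by
  rw [maxBelow, Finset.sup_lt_iff (by simp)]
  exact fun v _ => ident_lt k _

/-- The binary search for the largest identifier below `u₀`. -/
theorem exec_search {k w e u₀ lo₀ s : ℕ} {acc cnt u lo : Fin n → ℕ}
    (hu : ∀ v ∈ members ω k w, u v = u₀) (hlo : ∀ v ∈ members ω k w, lo v = lo₀)
    (h1 : lo₀ ≤ maxBelow ω k w u₀) (h2 : maxBelow ω k w u₀ < lo₀ + 2 ^ s) :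
    ∃ lo' : Fin n → ℕ, (∀ v ∈ members ω k w, lo' v = maxBelow ω k w u₀) ∧
      Exec ω s (fun v => if v ∈ members ω k w then s else 0)
        (fun v => search k w (acc v) e (cnt v) (u v) (lo v) s)
        (fun v => search k w (acc v) e (cnt v) (u v) (lo' v) 0) := by
  induction s generalizing lo lo₀ with
  | zero =>
    refine ⟨lo, fun v hv => ?_, (Exec.refl _).mono fun v => by simp⟩
    rw [hlo v hv]
    omega
  | succ s ih =>
    set C : Fin n → NodeState := fun v => search k w (acc v) e (cnt v) (u v) (lo v) (s + 1) with hC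
    have hpos : 0 < 2 ^ s := by positivity
    have hb : busy ω C = decide (lo₀ + 2 ^ s ≤ maxBelow ω k w u₀) := by
      refine busy_eq_decide ?_
      rw [← exists_ident_iff (by omega)]
      refine exists_congr fun v => ?_
      by_cases hv : v ∈ members ω k w
      · have hv' := mem_members.1 hv
        simp only [hC, act, if_pos hv', hu v hv, hlo v hv, hv, true_and]
        split_ifs with h <;> simp [BeepDecision.isBeep, h]
      · have hv' := fun h => hv (mem_members.2 h)
        simp [hC, act, if_neg hv', hv, BeepDecision.isBeep]
    have hawake : ∀ v, (act (ω v) (C v)).isAwake = decide (v ∈ members ω k w) := by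
      intro v
      simp only [hC, act, mem_members]
      split_ifs with h h' <;> simp [BeepDecision.isAwake, h]
    -- Nodes outside the bucket sleep and keep their `lo`; only the members follow the common lower
    -- bound `lo₀`.
    have hstep : Exec ω 1 (fun v => if v ∈ members ω k w then 1 else 0) C fun v =>
        search k w (acc v) e (cnt v) (u v)
          (if v ∈ members ω k w ∧ lo₀ + 2 ^ s ≤ maxBelow ω k w u₀ then lo v + 2 ^ s else lo v) s := by
      refine Exec.single (fun v => ?_) fun v => ?_
      · rw [hawake, hb]
        simp [hC, update]
      · rw [hawake]
        by_cases hv : v ∈ members ω k w <;> simp [hv]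
    obtain ⟨lo', hlo', h⟩ := ih
      (lo₀ := if lo₀ + 2 ^ s ≤ maxBelow ω k w u₀ then lo₀ + 2 ^ s else lo₀)
      (lo := fun v => if v ∈ members ω k w ∧ lo₀ + 2 ^ s ≤ maxBelow ω k w u₀ then lo v + 2 ^ s
        else lo v)
      (fun v hv => by simp only [hv, true_and, hlo v hv])
      (by split_ifs <;> omega) (by rw [pow_succ] at h2; split_ifs <;> omega)
    refine ⟨lo', hlo', ?_⟩
    have h3 := hstep.trans h
    rw [Nat.add_comm 1 s] at h3
    refine h3.mono fun v => ?_
    by_cases hv : v ∈ members ω k w <;> simp [hv, Nat.add_comm]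

/-- Lowering the threshold to the next identifier adds exactly one node, by injectivity. The value
`0` means that no member is below `u`, since identifiers are positive, and then nothing is added. -/
theorem card_ident_ge_maxBelow {k w u : ℕ}
    (hinj : Set.InjOn (fun v => ident k (ω v)) (members ω k w)) :
    ((members ω k w).filter fun v => maxBelow ω k w u ≤ ident k (ω v)).card =
      if maxBelow ω k w u = 0 then ((members ω k w).filter fun v => u ≤ ident k (ω v)).card
      else ((members ω k w).filter fun v => u ≤ ident k (ω v)).card + 1 := by
  split_ifs with h
  · congr 1
    refine Finset.filter_congr fun v hv => ?_
    rw [h]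
    refine ⟨fun _ => ?_, fun _ => Nat.zero_le _⟩
    by_contra hlt
    have h1 := le_maxBelow hv (not_le.1 hlt)
    have h2 := ident_pos k (ω v)
    omega
  · obtain ⟨v₀, hv₀, h1, h2⟩ := exists_eq_maxBelow (Nat.pos_of_ne_zero h)
    rw [← Finset.card_insert_of_notMem (a := v₀) (by simp [h1])]
    congr 1
    ext v
    simp only [Finset.mem_filter, Finset.mem_insert]
    constructor
    · rintro ⟨hv, hle⟩
      by_cases hu : u ≤ ident k (ω v)
      · exact Or.inr ⟨hv, hu⟩
      · have h3 := le_maxBelow hv (not_le.1 hu)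
        exact Or.inl (hinj hv hv₀ (by simp only []; omega))
    · rintro (rfl | ⟨hv, hu⟩)
      · exact ⟨hv₀, h2.ge⟩
      · exact ⟨hv, by omega⟩

/-- The repeated searches find all members of the bucket. -/
theorem exec_searches {k w e A u₀ c₀ : ℕ} {acc cnt u lo : Fin n → ℕ}
    (hinj : Set.InjOn (fun v => ident k (ω v)) (members ω k w))
    (hload : (members ω k w).card ≤ c₀ + e ∨ u₀ = 0)
    (hc₀ : c₀ = ((members ω k w).filter fun v => u₀ ≤ ident k (ω v)).card)
    (hacc : ∀ v ∈ members ω k w, acc v = A) (hcnt : ∀ v ∈ members ω k w, cnt v = c₀)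
    (hu : ∀ v ∈ members ω k w, u v = u₀) (hlo : ∀ v ∈ members ω k w, lo v = 0) :
    ∃ acc' : Fin n → ℕ, (∀ v ∈ members ω k w, acc' v = A + (members ω k w).card) ∧
      Exec ω ((e + 1) * (idBits k + 1))
        (fun v => if v ∈ members ω k w then (e + 1) * (idBits k + 1) else 0)
        (fun v => search k w (acc v) e (cnt v) (u v) (lo v) (idBits k))
        (fun v => send k w (acc' v) 0 (sizeBits k)) := by
  induction e generalizing cnt u lo u₀ c₀ with
  | zero =>
    -- The counter at `0` still runs one search, whose result is discarded; hence the factor `e +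
    -- 1`.
    obtain ⟨lo', -, h1⟩ := exec_search (e := 0) (acc := acc) (cnt := cnt) hu hlo (Nat.zero_le _)
      (by simpa using maxBelow_lt k w u₀)
    have h2 : Exec ω 1 0 (fun v => search k w (acc v) 0 (cnt v) (u v) (lo' v) 0)
        (fun v => send k w (acc v + cnt v) 0 (sizeBits k)) :=
      Exec.single (fun v => rfl) fun v => le_rfl
    refine ⟨fun v => acc v + cnt v, fun v hv => ?_, ?_⟩
    rotate_left
    · rw [Nat.zero_add, Nat.one_mul]
      refine (h1.trans h2).mono fun v => ?_
      by_cases hv : v ∈ members ω k w <;> simp [hv]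
    · simp only []
      rw [hacc v hv, hcnt v hv]
      have h3 : c₀ ≤ (members ω k w).card := hc₀ ▸ Finset.card_filter_le _ _
      rcases hload with h | rfl
      · omega
      · rw [hc₀, Finset.filter_true_of_mem fun _ _ => Nat.zero_le _]
  | succ e ih =>
    obtain ⟨lo', hlo', h1⟩ := exec_search (e := e + 1) (acc := acc) (cnt := cnt) hu hlo
      (Nat.zero_le _) (by simpa using maxBelow_lt k w u₀)
    have h2 : Exec ω 1 0 (fun v => search k w (acc v) (e + 1) (cnt v) (u v) (lo' v) 0)
        (fun v => search k w (acc v) e (if lo' v = 0 then cnt v else cnt v + 1) (lo' v) 0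
          (idBits k)) :=
      Exec.single (fun v => rfl) fun v => le_rfl
    have hcard := card_ident_ge_maxBelow (u := u₀) hinj
    rw [← hc₀] at hcard
    obtain ⟨acc', hacc', h3⟩ := ih (u₀ := maxBelow ω k w u₀)
      (cnt := fun v => if lo' v = 0 then cnt v else cnt v + 1) (u := lo') (lo := fun _ => 0)
      (c₀ := if maxBelow ω k w u₀ = 0 then c₀ else c₀ + 1)
      (by
        -- A search either finds nothing, so the next threshold is `0`, or trades one remaining
        -- iteration for one more counted node.
        split_ifs with h
        · exact Or.inr h
        · rcases hload with h' | rfl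
          · exact Or.inl (by omega)
          · exact absurd (by simp [maxBelow]) h)
      hcard.symm (fun v hv => by simp only [hlo' v hv, hcnt v hv]) hlo' (fun _ _ => rfl)
    refine ⟨acc', hacc', ?_⟩
    have h4 := (h1.trans h2).trans h3
    rw [show idBits k + 1 + (e + 1) * (idBits k + 1) = (e + 1 + 1) * (idBits k + 1) by ring] at h4
    refine h4.mono fun v => ?_
    by_cases hv : v ∈ members ω k w
    · simp only [Pi.add_apply, if_pos hv, Pi.zero_apply]
      have h5 : (e + 1 + 1) * (idBits k + 1) = idBits k + 1 + (e + 1) * (idBits k + 1) := by ring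
      omega
    · simp [hv]

/-! ### Windows and the running total -/

/-- The nodes that are awake in some slot of window `w`. -/
def Concerned (k w : ℕ) (τ : CoinTape) : Prop :=
  bucket k τ = w ∨ bucket k τ = w + 1 ∨ w + 1 = 2 ^ bucketBits k

instance (k w : ℕ) (τ : CoinTape) : Decidable (Concerned k w τ) :=
  inferInstanceAs (Decidable (_ ∨ _ ∨ _))

/-- The transmission of the number `V` by the members of the bucket. -/
theorem exec_send {k w V r : ℕ} {val x : Fin n → ℕ} (hne : (members ω k w).Nonempty)
    (hval : ∀ v ∈ members ω k w, val v = V) (hx : ∀ v, Concerned k w (ω v) → x v = V / 2 ^ r) :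
    ∃ x' : Fin n → ℕ, (∀ v, Concerned k w (ω v) → x' v = V) ∧
      Exec ω r (fun v => if Concerned k w (ω v) then r else 0)
        (fun v => send k w (val v) (x v) r) (fun v => send k w (val v) (x' v) 0) := by
  induction r generalizing x with
  | zero => exact ⟨x, by simpa using hx, (Exec.refl _).mono fun v => by simp⟩
  | succ r ih =>
    set C : Fin n → NodeState := fun v => send k w (val v) (x v) (r + 1) with hC
    -- All members beep the same bit, and there is at least one of them, so the channel carries
    -- exactly bit `r` of `V`.
    have hb : busy ω C = V.testBit r := by
      rw [busy_eq_decide (p := V.testBit r = true), Bool.decide_eq_true]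
      obtain ⟨v₀, hv₀⟩ := hne
      constructor
      · rintro ⟨v, hv⟩
        simp only [hC, act] at hv
        split_ifs at hv with h1 h2
        · rwa [hval v (mem_members.2 h1)] at h2
        all_goals simp [BeepDecision.isBeep] at hv
      · intro h
        exact ⟨v₀, by simp [hC, act, mem_members.1 hv₀, hval v₀ hv₀, h, BeepDecision.isBeep]⟩
    have hawake : ∀ v, (act (ω v) (C v)).isAwake = decide (Concerned k w (ω v)) := by
      intro v
      simp only [hC, act, Concerned]
      split_ifs with h h' h'' <;> simp [BeepDecision.isAwake, *]
    have hstep : Exec ω 1 (fun v => if Concerned k w (ω v) then 1 else 0) C fun v =>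
        send k w (val v) (2 * x v + (decide (Concerned k w (ω v)) && V.testBit r).toNat) r := by
      refine Exec.single (fun v => ?_) fun v => ?_
      · rw [hawake, hb]
        rfl
      · rw [hawake]
        by_cases hv : Concerned k w (ω v) <;> simp [hv]
    obtain ⟨x', hx', h⟩ := ih
      (x := fun v => 2 * x v + (decide (Concerned k w (ω v)) && V.testBit r).toNat) fun v hv => by
        simp only [hx v hv, hv, decide_true, Bool.true_and]
        -- Appending bit `r` to `V / 2 ^ (r + 1)` gives `V / 2 ^ r`.
        rw [Nat.testBit_eq_decide_div_mod_eq, pow_succ, ← Nat.div_div_eq_div_mul]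
        rcases Nat.mod_two_eq_zero_or_one (V / 2 ^ r) with h0 | h0 <;> simp [h0] <;> omega
    refine ⟨x', hx', ?_⟩
    have h3 := hstep.trans h
    rw [Nat.add_comm 1 r] at h3
    refine h3.mono fun v => ?_
    by_cases hv : Concerned k w (ω v) <;> simp [hv, Nat.add_comm]

/-- The length of a window. -/
def windowLength (k : ℕ) : ℕ := (maxLoad k + 1) * (idBits k + 1) + (sizeBits k + 1)

variable (ω) in
/-- The properties of the random buckets and identifiers that the counting protocol relies on. -/
structure GoodLabels (k : ℕ) : Prop where
  size_lt : n < 2 ^ sizeBits k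
  ident_injective : Function.Injective fun v => ident k (ω v)
  members_nonempty : ∀ w < 2 ^ bucketBits k, (members ω k w).Nonempty
  card_members_le : ∀ w < 2 ^ bucketBits k, (members ω k w).card ≤ maxLoad k

theorem exec_window {k w A : ℕ} {acc : Fin n → ℕ} (hg : GoodLabels ω k) (hw : w < 2 ^ bucketBits k)
    (hacc : ∀ v ∈ members ω k w, acc v = A) (hA : A + (members ω k w).card ≤ n) :
    ∃ acc' : Fin n → ℕ, (∀ v, Concerned k w (ω v) → acc' v = A + (members ω k w).card) ∧
      Exec ω (windowLength k) (fun v => if Concerned k w (ω v) then windowLength k else 0)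
        (fun v => startWindow k w (acc v)) (fun v => finishWindow k w (acc' v)) := by
  obtain ⟨val, hval, h1⟩ := exec_searches (e := maxLoad k) (acc := acc) (cnt := fun _ => 0)
    (u := fun _ => 2 ^ idBits k) (lo := fun _ => 0) hg.ident_injective.injOn
    (Or.inl (by simpa using hg.card_members_le w hw))
    (by
      rw [eq_comm, Finset.card_eq_zero, Finset.filter_eq_empty_iff]
      exact fun v _ => not_le.2 (ident_lt k (ω v)))
    hacc (fun _ _ => rfl) (fun _ _ => rfl) (fun _ _ => rfl)
  -- The receivers start from `0`, which is `V / 2 ^ sizeBits k` because `V ≤ n < 2 ^ sizeBits k`.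
  obtain ⟨x', hx', h2⟩ := exec_send (r := sizeBits k) (x := fun _ => 0)
    (hg.members_nonempty w hw) hval fun v _ =>
      (Nat.div_eq_of_lt (hA.trans_lt hg.size_lt)).symm
  have h3 : Exec ω 1 0 (fun v => send k w (val v) (x' v) 0) (fun v => finishWindow k w (x' v)) :=
    Exec.single (fun v => rfl) fun v => le_rfl
  refine ⟨x', hx', ?_⟩
  have h4 := h1.trans (h2.trans h3)
  refine h4.mono fun v => ?_
  by_cases hv : v ∈ members ω k w
  · have hc : Concerned k w (ω v) := Or.inl (mem_members.1 hv)
    simp [hv, hc, windowLength]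
  · by_cases hc : Concerned k w (ω v) <;> simp [hv, hc, windowLength]
    omega

variable (ω) in
/-- The number of nodes in the buckets before bucket `w`. -/
def countBefore (k w : ℕ) : ℕ := (Finset.univ.filter fun v => bucket k (ω v) < w).card

theorem countBefore_succ (k w : ℕ) :
    countBefore ω k (w + 1) = countBefore ω k w + (members ω k w).card := by
  rw [countBefore, countBefore, members, ← Finset.card_union_of_disjoint]
  · congr 1
    ext v
    simp only [Finset.mem_filter, Finset.mem_union, Finset.mem_univ, true_and]
    omega
  · rw [Finset.disjoint_filter]
    intros
    omega

theorem countBefore_le (k w : ℕ) : countBefore ω k w ≤ n :=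
  (Finset.card_filter_le _ _).trans (Finset.card_fin n).le

theorem countBefore_two_pow (k : ℕ) : countBefore ω k (2 ^ bucketBits k) = n := by
  rw [countBefore, Finset.filter_true_of_mem fun v _ => bucket_lt k _]
  simp

/-- Only the members of the current bucket need a correct running total. They have it because they
listened in the preceding window. -/
theorem exec_windows {k w : ℕ} (hg : GoodLabels ω k) (hw : w < 2 ^ bucketBits k) :
    ∃ acc : Fin n → ℕ, (∀ v ∈ members ω k w, acc v = countBefore ω k w) ∧
      Exec ω (w * windowLength k)
        (fun v => ∑ w' ∈ Finset.range w, if Concerned k w' (ω v) then windowLength k else 0)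
        (fun _ => startWindow k 0 0) (fun v => startWindow k w (acc v)) := by
  induction w with
  | zero => exact ⟨fun _ => 0, fun v _ => by simp [countBefore], (by
    rw [Nat.zero_mul]
    exact Exec.refl _)⟩
  | succ w ih =>
    obtain ⟨acc, hacc, h1⟩ := ih (by omega)
    obtain ⟨acc', hacc', h2⟩ := exec_window hg (by omega) hacc
      (countBefore_succ k w ▸ countBefore_le k (w + 1))
    refine ⟨acc', fun v hv => ?_, ?_⟩
    · rw [hacc' v (Or.inr (Or.inl (mem_members.1 hv))), countBefore_succ]
    · simp only [finishWindow, if_neg hw.ne] at h2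
      have h3 := h1.trans h2
      rw [show w * windowLength k + windowLength k = (w + 1) * windowLength k by ring] at h3
      refine h3.mono fun v => ?_
      rw [Finset.sum_range_succ]
      rfl

/-- The three windows are the node's own, the one before it and the last one; this keeps the energy
at a constant number of windows. -/
theorem sum_concerned_le (k B L : ℕ) (hB : B = 2 ^ bucketBits k) (τ : CoinTape) :
    (∑ w ∈ Finset.range B, if Concerned k w τ then L else 0) ≤ 3 * L := by
  rw [← Finset.sum_filter, Finset.sum_const, smul_eq_mul]
  refine Nat.mul_le_mul_right _ ?_
  have hsub : (Finset.range B).filter (fun w => Concerned k w τ) ⊆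
      {bucket k τ, bucket k τ - 1, B - 1} := by
    intro w hw
    rw [Finset.mem_filter, Concerned] at hw
    simp only [Finset.mem_insert, Finset.mem_singleton]
    omega
  exact (Finset.card_le_card hsub).trans Finset.card_le_three

/-- In the last window all nodes are concerned, and the total over all buckets is `n`. -/
theorem exec_count {k : ℕ} (hg : GoodLabels ω k) :
    Exec ω (2 ^ bucketBits k * windowLength k) (fun _ => 3 * windowLength k)
      (fun _ => startWindow k 0 0) (fun _ => done n) := by
  have hpos : 0 < 2 ^ bucketBits k := by positivity
  obtain ⟨w, hw⟩ := Nat.exists_eq_succ_of_ne_zero hpos.ne'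
  obtain ⟨acc, hacc, h1⟩ := exec_windows (w := w) hg (by omega)
  obtain ⟨acc', hacc', h2⟩ := exec_window hg (by omega) hacc
    (countBefore_succ k w ▸ countBefore_le k (w + 1))
  have h3 : ∀ v, acc' v = n := fun v => by
    rw [hacc' v (Or.inr (Or.inr hw.symm)), ← countBefore_succ]
    exact (congrArg _ hw.symm).trans (countBefore_two_pow k)
  simp only [finishWindow, if_pos hw.symm, h3] at h2
  have h4 := h1.trans h2
  rw [show w * windowLength k + windowLength k = 2 ^ bucketBits k * windowLength k by
    rw [hw, Nat.succ_mul]] at h4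
  refine h4.mono fun v => ?_
  refine le_trans (le_of_eq ?_) (sum_concerned_le k _ (windowLength k) hw.symm (ω v))
  rw [Nat.succ_eq_add_one, Finset.sum_range_succ]
  rfl

/-- Correctness of the algorithm, for a good outcome of the coin flips. -/
theorem exec_algorithm {k : ℕ} (hk : firstPhase ≤ k)
    (h : ∀ j, firstPhase ≤ j → j < k → silentCount ω j (8 * j) < 4 * j)
    (hs : 4 * k ≤ silentCount ω k (8 * k)) (hg : GoodLabels ω k) :
    ∃ t ≤ (k + 1) * (8 * k + 1) + 2 ^ bucketBits k * windowLength k,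
      Exec ω t (fun _ => (k + 1) * (8 * k + 1) + 3 * windowLength k)
        (fun _ => startPhase firstPhase) (fun _ => done n) := by
  obtain ⟨t, ht, h1⟩ := exec_estimation hk h hs
  exact ⟨_, Nat.add_le_add_right ht _, (h1.trans (exec_count hg)).mono fun v =>
    Nat.add_le_add_right ht _⟩


/-! ### Probabilities of events concerning one tape -/

theorem uniformBool_singleton (b : Bool) :
    (PMF.uniformOfFintype Bool).toMeasure {b} = (1 / 2 : ENNReal) := by
  rw [PMF.toMeasure_apply_singleton _ _ (measurableSet_singleton b)]
  simp

/-- The probability that finitely many bits have given values. -/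
theorem coin_cylinder (T : Finset ℕ) (f : ℕ → Bool) :
    coinTapeMeasure.real {τ | ∀ r ∈ T, τ r = f r} = (1 / 2) ^ T.card := by
  have h : {τ : CoinTape | ∀ r ∈ T, τ r = f r} = (T : Set ℕ).pi fun r => {f r} := by
    ext τ
    simp [Set.pi]
  rw [h, Measure.real, coinTapeMeasure, Measure.infinitePi_pi]
  · simp only [uniformBool_singleton, Finset.prod_const]
    simp
  · exact fun r _ => measurableSet_singleton _

/-- Events that depend on disjoint finite sets of bits are independent. -/
theorem coin_inter {U V : Finset ℕ} (hUV : Disjoint U V) {A B : Set CoinTape}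
    (hA : ∀ τ τ' : CoinTape, (∀ r ∈ U, τ r = τ' r) → τ ∈ A → τ' ∈ A)
    (hB : ∀ τ τ' : CoinTape, (∀ r ∈ V, τ r = τ' r) → τ ∈ B → τ' ∈ B) :
    coinTapeMeasure.real (A ∩ B) = coinTapeMeasure.real A * coinTapeMeasure.real B := by
  have hind : ProbabilityTheory.iIndepFun (fun (i : ℕ) (τ : CoinTape) => τ i) coinTapeMeasure :=
    ProbabilityTheory.iIndepFun_infinitePi (X := fun _ b => b) fun _ => measurable_id
  have h := hind.indepFun_finset U V hUV fun i => measurable_pi_apply i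
  -- An event determined by the bits in `W` is the preimage of its image under restriction to `W`.
  -- The restrictions form a finite space, so measurability is automatic.
  have key : ∀ (W : Finset ℕ) (C : Set CoinTape),
      (∀ τ τ' : CoinTape, (∀ r ∈ W, τ r = τ' r) → τ ∈ C → τ' ∈ C) →
      (fun (τ : CoinTape) (i : W) => τ i) ⁻¹' ((fun (τ : CoinTape) (i : W) => τ i) '' C) = C := by
    intro W C hC
    refine Set.Subset.antisymm ?_ (Set.subset_preimage_image _ _)
    rintro τ ⟨τ', h1, h2⟩
    exact hC τ' τ (fun r hr => congrFun h2 ⟨r, hr⟩) h1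
  have h1 := h.measure_inter_preimage_eq_mul _ _
    (Set.toFinite ((fun (τ : CoinTape) (i : U) => τ i) '' A)).measurableSet
    (Set.toFinite ((fun (τ : CoinTape) (i : V) => τ i) '' B)).measurableSet
  rw [key U A hA, key V B hB] at h1
  rw [Measure.real, h1, ENNReal.toReal_mul]
  rfl

theorem coin_blockTrue (j i : ℕ) : coinTapeMeasure.real {τ | blockTrue j i τ} = (1 / 2) ^ j := by
  have h := coin_cylinder ((Finset.range j).image fun r => i * j + r) fun _ => true
  rw [Finset.card_image_of_injective _ (add_right_injective (i * j)), Finset.card_range] at h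
  rw [← h]
  congr 1
  ext τ
  simp [blockTrue]

theorem blockTrue_congr {j i : ℕ} {τ τ' : CoinTape}
    (h : ∀ r ∈ (Finset.range j).image fun r => i * j + r, τ r = τ' r) :
    blockTrue j i τ ↔ blockTrue j i τ' := by
  refine forall₂_congr fun r hr => ?_
  rw [h _ (Finset.mem_image_of_mem _ (Finset.mem_range.2 hr))]

/-- Distinct slots of a phase read disjoint blocks of `j` bits. The proposition `c` treats "beeps in
all of `S`" and "beeps in none of `S`" together. -/
theorem coin_blocks (j : ℕ) (S : Finset ℕ) (c : Prop) :
    coinTapeMeasure.real {τ | ∀ i ∈ S, (blockTrue j i τ ↔ c)} =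
      coinTapeMeasure.real {τ | blockTrue j 0 τ ↔ c} ^ S.card := by
  have hone : ∀ i, coinTapeMeasure.real {τ | blockTrue j i τ ↔ c} =
      coinTapeMeasure.real {τ | blockTrue j 0 τ ↔ c} := by
    intro i
    by_cases hc : c
    · simp only [hc, iff_true, coin_blockTrue]
    · simp only [hc, iff_false]
      have h : ∀ i, coinTapeMeasure.real {τ | ¬ blockTrue j i τ} = 1 - (1 / 2) ^ j := fun i => by
        rw [← coin_blockTrue j i, ← probReal_compl_eq_one_sub (measurableSet_blockTrue j i)]
        rfl
      rw [h, h]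
  induction S using Finset.induction_on with
  | empty => simp
  | insert i S hi ih =>
    rw [Finset.card_insert_of_notMem hi, pow_succ', ← ih, ← hone i]
    have hset : {τ | ∀ i' ∈ insert i S, (blockTrue j i' τ ↔ c)} =
        {τ | blockTrue j i τ ↔ c} ∩ {τ | ∀ i' ∈ S, (blockTrue j i' τ ↔ c)} := by
      ext τ
      simp
    rw [hset]
    refine coin_inter (U := (Finset.range j).image fun r => i * j + r)
      (V := S.biUnion fun i' => (Finset.range j).image fun r => i' * j + r) ?_ ?_ ?_
    · rw [Finset.disjoint_biUnion_right]
      intro i' hi'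
      rw [Finset.disjoint_left]
      intro x hx hx'
      rw [Finset.mem_image] at hx hx'
      obtain ⟨r, hr, rfl⟩ := hx
      obtain ⟨r', hr', h⟩ := hx'
      rw [Finset.mem_range] at hr hr'
      -- Division by `j` recovers the slot from a bit position, so the blocks are disjoint.
      have h1 : (i' * j + r') / j = (i * j + r) / j := by rw [h]
      rw [mul_comm i', mul_comm i, Nat.mul_add_div (by omega), Nat.mul_add_div (by omega),
        Nat.div_eq_of_lt hr, Nat.div_eq_of_lt hr'] at h1
      rw [Nat.add_zero, Nat.add_zero] at h1
      exact hi (h1 ▸ hi')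
    · intro τ τ' h hτ
      exact (blockTrue_congr h).symm.trans hτ
    · intro τ τ' h hτ i' hi'
      refine (blockTrue_congr fun r hr => h r ?_).symm.trans (hτ i' hi')
      exact Finset.mem_biUnion.2 ⟨i', hi', hr⟩

theorem coin_forall_blockTrue (j : ℕ) (S : Finset ℕ) :
    coinTapeMeasure.real {τ | ∀ i ∈ S, blockTrue j i τ} = ((1 / 2) ^ j) ^ S.card := by
  have h := coin_blocks j S True
  simpa only [iff_true, coin_blockTrue] using h

theorem coin_forall_not_blockTrue (j : ℕ) (S : Finset ℕ) :
    coinTapeMeasure.real {τ | ∀ i ∈ S, ¬ blockTrue j i τ} = (1 - (1 / 2) ^ j) ^ S.card := by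
  have h := coin_blocks j S False
  simp only [iff_false] at h
  rw [h, ← coin_blockTrue j 0, ← probReal_compl_eq_one_sub (measurableSet_blockTrue j 0)]
  rfl

theorem testBit_prefixVal {m r : ℕ} (τ : CoinTape) (hr : r < m) :
    (prefixVal m τ).testBit r = τ r := by
  induction m with
  | zero => omega
  | succ m ih =>
    have hlt := prefixVal_lt m τ
    have hs : prefixVal (m + 1) τ = (if τ m then 2 ^ m else 0) + prefixVal m τ := by
      rw [prefixVal, Finset.sum_range_succ, add_comm]
      rfl
    rcases Nat.lt_succ_iff_lt_or_eq.1 hr with h | rfl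
    · rw [hs, ← ih h]
      split_ifs
      · rw [Nat.testBit_two_pow_add_gt h]
      · rw [Nat.zero_add]
    · rw [hs]
      cases hτ : τ r
      · simpa using Nat.testBit_lt_two_pow hlt
      · simp [Nat.testBit_two_pow_add_eq, Nat.testBit_lt_two_pow hlt]

theorem coin_prefixVal {m x : ℕ} (hx : x < 2 ^ m) :
    coinTapeMeasure.real {τ | prefixVal m τ = x} = (1 / 2) ^ m := by
  have h := coin_cylinder (Finset.range m) fun r => x.testBit r
  rw [Finset.card_range] at h
  rw [← h]
  congr 1
  ext τ
  simp only [Set.mem_ofPred_eq, Finset.mem_range]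
  constructor
  · rintro rfl r hr
    rw [testBit_prefixVal τ hr]
  · intro h
    refine Nat.eq_of_testBit_eq fun r => ?_
    by_cases hr : r < m
    · rw [testBit_prefixVal τ hr, h r hr]
    · have h2 : 2 ^ m ≤ 2 ^ r := Nat.pow_le_pow_right (by norm_num) (not_lt.1 hr)
      rw [Nat.testBit_lt_two_pow (hx.trans_le h2),
        Nat.testBit_lt_two_pow ((prefixVal_lt m τ).trans_le h2)]

/-! ### Probabilities of events concerning the network -/

instance (n : ℕ) : IsProbabilityMeasure (networkMeasure n) := by
  unfold networkMeasure
  infer_instance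

theorem network_pi {n : ℕ} (A : Fin n → Set CoinTape) :
    (networkMeasure n).real {ω | ∀ v, ω v ∈ A v} = ∏ v, coinTapeMeasure.real (A v) := by
  have h : {ω : Fin n → CoinTape | ∀ v, ω v ∈ A v} = Set.univ.pi A := by
    ext ω
    simp [Set.pi]
  rw [h, Measure.real, networkMeasure, Measure.pi_pi, ENNReal.toReal_prod]
  rfl

theorem network_biUnion_le {n : ℕ} {α : Type*} {E : Set (Fin n → CoinTape)} (s : Finset α)
    (F : α → Set (Fin n → CoinTape)) (hE : ∀ ω ∈ E, ∃ a ∈ s, ω ∈ F a) {p : ℝ}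
    (hp : ∀ a ∈ s, (networkMeasure n).real (F a) ≤ p) :
    (networkMeasure n).real E ≤ s.card * p := by
  calc (networkMeasure n).real E ≤ (networkMeasure n).real (⋃ a ∈ s, F a) :=
        measureReal_mono (fun ω hω => by simpa using hE ω hω)
          (measure_ne_top _ _)
    _ ≤ ∑ a ∈ s, (networkMeasure n).real (F a) := measureReal_biUnion_finset_le _ _
    _ ≤ s.card * p := by
        rw [← nsmul_eq_mul]
        exact Finset.sum_le_card_nsmul _ _ _ hp

/-- Union bound over the sets of `4 * j` slots, at most `2 ^ (8 * j)` in number; in a given set each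
node must be silent throughout, independently of the others. -/
theorem network_many_silent (n j : ℕ) :
    (networkMeasure n).real {ω | 4 * j ≤ silentCount ω j (8 * j)} ≤
      2 ^ (8 * j) * ((1 - (1 / 2) ^ j) ^ (4 * j)) ^ n := by
  have h := network_biUnion_le (E := {ω : Fin n → CoinTape | 4 * j ≤ silentCount ω j (8 * j)})
    ((Finset.range (8 * j)).powerset.filter fun S => S.card = 4 * j)
    (fun S => {ω | ∀ v, ω v ∈ {τ | ∀ i ∈ S, ¬ blockTrue j i τ}})
    (fun ω hω => by
      obtain ⟨S, hS, hc⟩ := Finset.exists_subset_card_eq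
        (show 4 * j ≤ silentCount ω j (8 * j) from hω)
      refine ⟨S, ?_, fun v i hi => (Finset.mem_filter.1 (hS hi)).2 v⟩
      rw [Finset.mem_filter, Finset.mem_powerset]
      exact ⟨hS.trans (Finset.filter_subset _ _), hc⟩)
    (p := ((1 - (1 / 2) ^ j) ^ (4 * j)) ^ n)
    (fun S hS => by
      rw [network_pi]
      simp only [coin_forall_not_blockTrue, (Finset.mem_filter.1 hS).2]
      simp)
  refine h.trans (mul_le_mul_of_nonneg_right ?_ ?_)
  · have hc := Finset.card_filter_le (Finset.range (8 * j)).powerset fun S => S.card = 4 * j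
    rw [Finset.card_powerset, Finset.card_range] at hc
    exact_mod_cast hc
  · have : (1 / 2 : ℝ) ^ j ≤ 1 := pow_le_one₀ (by norm_num) (by norm_num)
    exact pow_nonneg (pow_nonneg (by linarith) _) _

/-- Union bound over sets of `4 * j` busy slots, and for each set over the functions assigning to
every slot a node that beeps in it. -/
theorem network_many_busy (n j : ℕ) :
    (networkMeasure n).real {ω | silentCount ω j (8 * j) < 4 * j} ≤
      2 ^ (8 * j) * (n * (1 / 2) ^ j) ^ (4 * j) := by
  have hS : ∀ S ∈ (Finset.range (8 * j)).powerset.filter fun S => S.card = 4 * j,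
      (networkMeasure n).real {ω | ∀ i ∈ S, ∃ v, blockTrue j i (ω v)} ≤
        (n * (1 / 2) ^ j) ^ (4 * j) := by
    intro S hS
    have hc := (Finset.mem_filter.1 hS).2
    have h := network_biUnion_le (E := {ω : Fin n → CoinTape | ∀ i ∈ S, ∃ v, blockTrue j i (ω v)})
      (Finset.univ : Finset (S → Fin n))
      (fun f => {ω | ∀ v, ω v ∈
        {τ | ∀ i ∈ (S.attach.filter fun i => f i = v).image Subtype.val, blockTrue j i τ}})
      (fun ω hω => by
        have hω' : ∀ i : S, ∃ v, blockTrue j i (ω v) := fun i => hω i i.2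
        choose f hf using hω'
        refine ⟨f, Finset.mem_univ _, fun v i hi => ?_⟩
        simp only [Finset.mem_image, Finset.mem_filter, Finset.mem_attach, true_and] at hi
        obtain ⟨i', rfl, rfl⟩ := hi
        exact hf i')
      (p := ((1 / 2) ^ j) ^ (4 * j))
      (fun f _ => by
        rw [network_pi]
        simp only [coin_forall_blockTrue, Finset.card_image_of_injective _ Subtype.val_injective]
        -- The fibres of `f` partition `S`, so the exponents add up to `4 * j`.
        rw [Finset.prod_pow_eq_pow_sum, ← Finset.card_eq_sum_card_fiberwise (by simp [Set.MapsTo]),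
          Finset.card_attach, hc])
    rw [mul_pow]
    refine h.trans_eq ?_
    simp [hc]
  have h := network_biUnion_le (E := {ω : Fin n → CoinTape | silentCount ω j (8 * j) < 4 * j})
    ((Finset.range (8 * j)).powerset.filter fun S => S.card = 4 * j)
    (fun S => {ω | ∀ i ∈ S, ∃ v, blockTrue j i (ω v)})
    (fun ω hω => by
      have hsum := Finset.card_filter_add_card_filter_not (s := Finset.range (8 * j))
        (fun i => ∀ v, ¬ blockTrue j i (ω v))
      rw [Finset.card_range] at hsum
      have hω' : ((Finset.range (8 * j)).filter fun i => ∀ v, ¬ blockTrue j i (ω v)).card < 4 * j :=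
        hω
      obtain ⟨S, hS, hc⟩ := Finset.exists_subset_card_eq (n := 4 * j)
        (s := (Finset.range (8 * j)).filter fun i => ¬ ∀ v, ¬ blockTrue j i (ω v)) (by omega)
      refine ⟨S, ?_, fun i hi => not_forall_not.1 (Finset.mem_filter.1 (hS hi)).2⟩
      rw [Finset.mem_filter, Finset.mem_powerset]
      exact ⟨hS.trans (Finset.filter_subset _ _), hc⟩)
    hS
  refine h.trans (mul_le_mul_of_nonneg_right ?_ (by positivity))
  have hc := Finset.card_filter_le (Finset.range (8 * j)).powerset fun S => S.card = 4 * j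
  rw [Finset.card_powerset, Finset.card_range] at hc
  exact_mod_cast hc

theorem network_empty_bucket (n k : ℕ) :
    (networkMeasure n).real {ω | ∃ w < 2 ^ bucketBits k, members ω k w = ∅} ≤
      2 ^ bucketBits k * (1 - (1 / 2) ^ bucketBits k) ^ n := by
  have h := network_biUnion_le
    (E := {ω : Fin n → CoinTape | ∃ w < 2 ^ bucketBits k, members ω k w = ∅})
    (Finset.range (2 ^ bucketBits k))
    (fun w => {ω | ∀ v, ω v ∈ {τ | prefixVal (bucketBits k) τ = w}ᶜ})
    (fun ω ⟨w, hw, he⟩ => ⟨w, Finset.mem_range.2 hw, fun v hv =>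
      Finset.notMem_empty v (he ▸ mem_members.2 hv)⟩)
    (p := (1 - (1 / 2) ^ bucketBits k) ^ n)
    (fun w hw => by
      have hm : MeasurableSet {τ : CoinTape | prefixVal (bucketBits k) τ = w} :=
        measurable_prefixVal _ (measurableSet_singleton w)
      rw [network_pi]
      simp [probReal_compl_eq_one_sub hm, coin_prefixVal (Finset.mem_range.1 hw)])
  simpa using h

/-- A bucket with more than `m` members contains some `m`-element set of nodes, over which the union
bound runs. -/
theorem network_heavy_bucket (n k m : ℕ) :
    (networkMeasure n).real {ω | ∃ w < 2 ^ bucketBits k, m < (members ω k w).card} ≤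
      2 ^ bucketBits k * (n.choose m * ((1 / 2) ^ bucketBits k) ^ m) := by
  have h1 : ∀ w ∈ Finset.range (2 ^ bucketBits k),
      (networkMeasure n).real {ω | m < (members ω k w).card} ≤
        n.choose m * ((1 / 2) ^ bucketBits k) ^ m := by
    intro w hw
    have h := network_biUnion_le (E := {ω : Fin n → CoinTape | m < (members ω k w).card})
      (Finset.univ.powersetCard m)
      (fun S => {ω | ∀ v, ω v ∈
        if v ∈ S then {τ | prefixVal (bucketBits k) τ = w} else Set.univ})
      (fun ω hω => by
        obtain ⟨S, hS, hc⟩ := Finset.exists_subset_card_eq (n := m) (le_of_lt hω)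
        refine ⟨S, Finset.mem_powersetCard.2 ⟨Finset.subset_univ _, hc⟩, fun v => ?_⟩
        split_ifs with hv
        · exact mem_members.1 (hS hv)
        · trivial)
      (p := ((1 / 2) ^ bucketBits k) ^ m)
      (fun S hS => by
        rw [network_pi]
        simp only [apply_ite, coin_prefixVal (Finset.mem_range.1 hw), probReal_univ]
        rw [Finset.prod_ite_mem]
        simp [(Finset.mem_powersetCard.1 hS).2])
    simpa using h
  have h := network_biUnion_le
    (E := {ω : Fin n → CoinTape | ∃ w < 2 ^ bucketBits k, m < (members ω k w).card})
    (Finset.range (2 ^ bucketBits k)) (fun w => {ω | m < (members ω k w).card})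
    (fun ω ⟨w, hw, he⟩ => ⟨w, Finset.mem_range.2 hw, he⟩) h1
  simpa using h

/-- Union bound over ordered pairs of distinct nodes and, for each pair, over the common value. -/
theorem network_ident_collision (n k : ℕ) :
    (networkMeasure n).real {ω | ¬ Function.Injective fun v => ident k (ω v)} ≤
      (n : ℝ) ^ 2 * (1 / 2) ^ (4 * k) := by
  have h1 : ∀ p ∈ (Finset.univ : Finset (Fin n)).offDiag, (networkMeasure n).real
      {ω | prefixVal (4 * k) (ω p.1) = prefixVal (4 * k) (ω p.2)} ≤ (1 / 2) ^ (4 * k) := by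
    intro p hp
    have hne := (Finset.mem_offDiag.1 hp).2.2
    have h := network_biUnion_le
      (E := {ω : Fin n → CoinTape | prefixVal (4 * k) (ω p.1) = prefixVal (4 * k) (ω p.2)})
      (Finset.range (2 ^ (4 * k)))
      (fun x => {ω | ∀ v, ω v ∈
        if v ∈ ({p.1, p.2} : Finset (Fin n)) then {τ | prefixVal (4 * k) τ = x} else Set.univ})
      (fun ω hω => by
        refine ⟨_, Finset.mem_range.2 (prefixVal_lt (4 * k) (ω p.1)), fun v => ?_⟩
        split_ifs with hv
        · rw [Finset.mem_insert, Finset.mem_singleton] at hv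
          rcases hv with rfl | rfl
          · rfl
          · exact hω.symm
        · trivial)
      (p := ((1 / 2) ^ (4 * k)) ^ 2)
      (fun x hx => by
        rw [network_pi]
        simp only [apply_ite, coin_prefixVal (Finset.mem_range.1 hx), probReal_univ]
        rw [Finset.prod_ite_mem]
        simp [Finset.card_pair hne])
    refine h.trans_eq ?_
    rw [Finset.card_range, sq, ← mul_assoc]
    push_cast
    rw [← mul_pow]
    norm_num
  have h := network_biUnion_le
    (E := {ω : Fin n → CoinTape | ¬ Function.Injective fun v => ident k (ω v)})
    (Finset.univ : Finset (Fin n)).offDiag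
    (fun p => {ω | prefixVal (4 * k) (ω p.1) = prefixVal (4 * k) (ω p.2)})
    (fun ω hω => by
      simp only [Function.Injective, Set.mem_ofPred_eq, not_forall] at hω
      obtain ⟨u, v, he, hne⟩ := hω
      exact ⟨(u, v), by simpa using hne, Nat.succ_injective he⟩) h1
  refine h.trans (mul_le_mul_of_nonneg_right ?_ (by positivity))
  rw [Finset.offDiag_card, Finset.card_univ, Fintype.card_fin, sq]
  exact_mod_cast Nat.sub_le _ _


/-! ### Estimates -/

theorem half_pow_eq (k : ℕ) : (1 / 2 : ℝ) ^ k = 1 / 2 ^ k := by rw [div_pow, one_pow]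

/-- With `y = n / 2 ^ j ≥ 4` the left side is at most `exp (8 * j - 4 * j * y) ≤ exp (-2 * j * y)`,
and `log n ≤ j + (y - 1) ≤ j * y`. -/
theorem many_silent_bound {n j : ℕ} (hj : 1 ≤ j) (h : 4 * 2 ^ j ≤ n) :
    (2 : ℝ) ^ (8 * j) * ((1 - (1 / 2) ^ j) ^ (4 * j)) ^ n ≤ 1 / (n : ℝ) ^ 2 := by
  have hn : (4 : ℝ) * 2 ^ j ≤ n := by exact_mod_cast h
  have hp : (0 : ℝ) < 2 ^ j := by positivity
  have hn0 : (0 : ℝ) < n := by linarith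
  set y : ℝ := n * (1 / 2) ^ j with hy
  have hxle : (1 / 2 : ℝ) ^ j ≤ 1 := pow_le_one₀ (by norm_num) (by norm_num)
  have hy4 : 4 ≤ y := by
    rw [hy, half_pow_eq, mul_one_div, le_div_iff₀ hp]
    exact hn
  have hj1 : (1 : ℝ) ≤ j := by exact_mod_cast hj
  have hlog : Real.log n ≤ j * y := by
    have h1 : (n : ℝ) = 2 ^ j * y := by
      rw [hy, half_pow_eq]
      field_simp
    rw [h1, Real.log_mul (by positivity) (by positivity), Real.log_pow]
    have h2 := Real.log_le_sub_one_of_pos (show 0 < y by linarith)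
    have h3 : Real.log 2 ≤ 1 := by linarith [Real.log_two_lt_d9]
    nlinarith [mul_nonneg (sub_nonneg.2 hj1) (show 0 ≤ y - 1 by linarith)]
  have h2 : (2 : ℝ) ^ (8 * j) ≤ Real.exp (8 * j) := by
    have h3 : (2 : ℝ) ≤ Real.exp 1 := by linarith [Real.add_one_le_exp 1]
    calc (2 : ℝ) ^ (8 * j) ≤ Real.exp 1 ^ (8 * j) := pow_le_pow_left₀ (by norm_num) h3 _
      _ = Real.exp (8 * j) := by rw [← Real.exp_nat_mul]; push_cast; ring_nf
  have h4 : ((1 - (1 / 2 : ℝ) ^ j) ^ (4 * j)) ^ n ≤ Real.exp (-(4 * j * y)) := by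
    calc ((1 - (1 / 2 : ℝ) ^ j) ^ (4 * j)) ^ n
        ≤ (Real.exp (-(1 / 2 : ℝ) ^ j) ^ (4 * j)) ^ n := by
          refine pow_le_pow_left₀ (pow_nonneg (by linarith) _)
            (pow_le_pow_left₀ (by linarith) ?_ _) _
          linarith [Real.add_one_le_exp (-(1 / 2 : ℝ) ^ j)]
      _ = Real.exp (-(4 * j * y)) := by
          rw [← Real.exp_nat_mul, ← Real.exp_nat_mul, hy]
          push_cast
          ring_nf
  calc (2 : ℝ) ^ (8 * j) * ((1 - (1 / 2) ^ j) ^ (4 * j)) ^ n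
      ≤ Real.exp (8 * j) * Real.exp (-(4 * j * y)) :=
        mul_le_mul h2 h4 (pow_nonneg (pow_nonneg (by linarith) _) _) (Real.exp_pos _).le
    _ = Real.exp (8 * j - 4 * j * y) := by rw [← Real.exp_add]; ring_nf
    _ ≤ Real.exp (-(2 * Real.log n)) := by
        refine Real.exp_le_exp.2 ?_
        nlinarith
    _ = 1 / (n : ℝ) ^ 2 := by
        rw [Real.exp_neg, one_div, two_mul, Real.exp_add, Real.exp_log hn0, sq]

theorem many_busy_bound {n k : ℕ} (h : 16 * n ≤ 2 ^ k) :
    (2 : ℝ) ^ (8 * k) * (n * (1 / 2) ^ k) ^ (4 * k) ≤ (1 / 2) ^ k := by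
  have hn : (16 : ℝ) * n ≤ 2 ^ k := by exact_mod_cast h
  have hx : (n : ℝ) * (1 / 2) ^ k ≤ 1 / 16 := by
    rw [half_pow_eq, mul_one_div, div_le_iff₀ (by positivity)]
    linarith
  calc (2 : ℝ) ^ (8 * k) * (n * (1 / 2) ^ k) ^ (4 * k)
      ≤ 2 ^ (8 * k) * (1 / 16) ^ (4 * k) := by gcongr
    _ = (1 / 256) ^ k := by
        rw [pow_mul, pow_mul, ← mul_pow]
        norm_num
    _ ≤ (1 / 2) ^ k := pow_le_pow_left₀ (by norm_num) (by norm_num) _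

theorem log_add_le {k : ℕ} (hk : 20 ≤ k) : Nat.log 2 k + 16 ≤ k := by
  have h : k < 2 ^ (k - 15) := by
    induction k, hk using Nat.le_induction with
    | base => norm_num
    | succ k hk ih =>
      rw [show k + 1 - 15 = k - 15 + 1 by omega, pow_succ]
      omega
  have := Nat.log_lt_of_lt_pow (by omega) h
  omega

theorem two_pow_bucketBits_mul {k : ℕ} (hk : 20 ≤ k) :
    2 ^ bucketBits k * (2 ^ 16 * 2 ^ Nat.log 2 k) = 2 ^ k := by
  have h := log_add_le hk
  rw [← pow_add, ← pow_add, bucketBits]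
  congr 1
  omega

/-- For `k = 20` there is a single bucket, nonempty as `n ≥ 1`. Otherwise the mean load is at least
`2 * k`, so a bucket is empty with probability at most `exp (-2 * k) ≤ 4 ^ (-k)`, against at most `2
^ k` buckets. -/
theorem empty_bucket_bound {n k : ℕ} (hk : 20 ≤ k) (hn : 1 ≤ n) (h : k = 20 ∨ 2 ^ k ≤ 32 * n) :
    (2 : ℝ) ^ bucketBits k * (1 - (1 / 2) ^ bucketBits k) ^ n ≤ (1 / 2) ^ k := by
  rcases h with rfl | h
  · have hb : bucketBits 20 = 0 := by
      have : Nat.log 2 20 = 4 := by norm_num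
      simp [bucketBits, this]
    rw [hb, pow_zero, pow_zero, sub_self, zero_pow (by omega)]
    norm_num
  have hB := two_pow_bucketBits_mul hk
  have hk2 : k < 2 ^ Nat.log 2 k * 2 := by
    have := Nat.lt_pow_succ_log_self (b := 2) (by norm_num) k
    rwa [pow_succ] at this
  have hle : 2 * k * 2 ^ bucketBits k ≤ n := by
    have hpos : 0 < 2 ^ bucketBits k := by positivity
    have h1 : 2 ^ bucketBits k * k ≤ 2 ^ bucketBits k * (2 ^ Nat.log 2 k * 2) :=
      Nat.mul_le_mul_left _ hk2.le
    nlinarith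
  have hle' : (2 * k : ℝ) * 2 ^ bucketBits k ≤ n := by exact_mod_cast hle
  have hble : bucketBits k ≤ k := Nat.sub_le _ _
  have hxle : (1 / 2 : ℝ) ^ bucketBits k ≤ 1 := pow_le_one₀ (by norm_num) (by norm_num)
  have h1 : (1 - (1 / 2 : ℝ) ^ bucketBits k) ^ n ≤ (1 / 4) ^ k := by
    calc (1 - (1 / 2 : ℝ) ^ bucketBits k) ^ n
        ≤ Real.exp (-(1 / 2 : ℝ) ^ bucketBits k) ^ n :=
          pow_le_pow_left₀ (by linarith)
            (by linarith [Real.add_one_le_exp (-(1 / 2 : ℝ) ^ bucketBits k)]) _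
      _ = Real.exp (-(n * (1 / 2 : ℝ) ^ bucketBits k)) := by
          rw [← Real.exp_nat_mul]
          ring_nf
      _ ≤ Real.exp (-(2 * k)) := by
          refine Real.exp_le_exp.2 (neg_le_neg ?_)
          rw [half_pow_eq, mul_one_div, le_div_iff₀ (by positivity)]
          exact hle'
      _ = (Real.exp (-1) ^ 2) ^ k := by
          rw [← pow_mul, ← Real.exp_nat_mul]
          push_cast
          ring_nf
      _ ≤ ((1 / 2) ^ 2) ^ k := by
          have h3 : Real.exp (-1) ≤ 1 / 2 := by
            rw [Real.exp_neg, ← one_div]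
            exact one_div_le_one_div_of_le (by norm_num) (by linarith [Real.add_one_le_exp 1])
          gcongr
      _ = (1 / 4) ^ k := by norm_num
  calc (2 : ℝ) ^ bucketBits k * (1 - (1 / 2) ^ bucketBits k) ^ n
      ≤ 2 ^ k * (1 / 4) ^ k :=
        mul_le_mul (pow_le_pow_right₀ (by norm_num) hble) h1 (pow_nonneg (by linarith) _)
          (by positivity)
    _ = (1 / 2) ^ k := by rw [← mul_pow]; norm_num

/-- One term of the exponential series gives `(8 * z) ^ m / m! ≤ exp (8 * z) ≤ 4 ^ m`; divide by `8
^ m`. -/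
theorem pow_div_factorial_le {z : ℝ} (hz : 0 ≤ z) {m : ℕ} (h : 8 * z ≤ m) :
    z ^ m / m.factorial ≤ (1 / 2) ^ m := by
  have h1 := Real.pow_div_factorial_le_exp (8 * z) (by linarith) m
  have h2 : Real.exp (8 * z) ≤ 4 ^ m := by
    calc Real.exp (8 * z) ≤ Real.exp m := Real.exp_le_exp.2 h
      _ = Real.exp 1 ^ m := by rw [← Real.exp_nat_mul, mul_one]
      _ ≤ 4 ^ m := pow_le_pow_left₀ (Real.exp_pos _).le (by linarith [Real.exp_one_lt_d9]) _
  rw [mul_pow, mul_div_assoc] at h1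
  have h3 : (4 : ℝ) ^ m = 8 ^ m * (1 / 2) ^ m := by rw [← mul_pow]; norm_num
  exact le_of_mul_le_mul_left ((h1.trans h2).trans_eq h3) (by positivity)

theorem heavy_bucket_bound {n k : ℕ} (hk : 20 ≤ k) (h : n < 4 * 2 ^ k) :
    (2 : ℝ) ^ bucketBits k * (n.choose (maxLoad k) * ((1 / 2) ^ bucketBits k) ^ maxLoad k) ≤
      (1 / 2) ^ k := by
  have hB := two_pow_bucketBits_mul hk
  have hl : 2 ^ Nat.log 2 k ≤ k := Nat.pow_log_le_self 2 (by omega)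
  -- The source of `2 ^ 21` in `maxLoad`: `8 * n < 2 ^ 5 * 2 ^ k`, and `2 ^ k` is at most `2 ^ 16 *
  -- k` times the number of buckets.
  have hz : 8 * n ≤ maxLoad k * 2 ^ bucketBits k := by
    have h1 : 2 ^ bucketBits k * 2 ^ Nat.log 2 k ≤ 2 ^ bucketBits k * k := Nat.mul_le_mul_left _ hl
    rw [maxLoad]
    nlinarith
  have hz' : (8 * n : ℝ) ≤ maxLoad k * 2 ^ bucketBits k := by exact_mod_cast hz
  have hm : 2 * k ≤ maxLoad k := Nat.mul_le_mul_right k (by norm_num)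
  generalize maxLoad k = m at *
  have h1 : (n.choose m : ℝ) * ((1 / 2) ^ bucketBits k) ^ m ≤ (1 / 2) ^ m := by
    calc (n.choose m : ℝ) * ((1 / 2) ^ bucketBits k) ^ m
        ≤ (n : ℝ) ^ m / m.factorial * ((1 / 2) ^ bucketBits k) ^ m :=
          mul_le_mul_of_nonneg_right (Nat.choose_le_pow_div m n) (by positivity)
      _ = (n * (1 / 2) ^ bucketBits k) ^ m / m.factorial := by rw [mul_pow]; ring
      _ ≤ (1 / 2) ^ m := by
          refine pow_div_factorial_le (by positivity) ?_
          rw [half_pow_eq, mul_one_div, ← mul_div_assoc, div_le_iff₀ (by positivity)]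
          exact hz'
  have hble : bucketBits k ≤ k := Nat.sub_le _ _
  calc (2 : ℝ) ^ bucketBits k * (n.choose m * ((1 / 2) ^ bucketBits k) ^ m)
      ≤ 2 ^ k * (1 / 2) ^ (2 * k) := by
        refine mul_le_mul (pow_le_pow_right₀ (by norm_num) hble) (h1.trans ?_) (by positivity)
          (by positivity)
        exact pow_le_pow_of_le_one (by norm_num) (by norm_num) hm
    _ = (1 / 2) ^ k := by rw [pow_mul, ← mul_pow]; norm_num

theorem ident_collision_bound {n k : ℕ} (hk : 20 ≤ k) (h : n < 4 * 2 ^ k) :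
    (n : ℝ) ^ 2 * (1 / 2) ^ (4 * k) ≤ (1 / 2) ^ k := by
  have h1 : (n : ℝ) ≤ 4 * 2 ^ k := by exact_mod_cast h.le
  have h2 : (16 : ℝ) * (1 / 2) ^ k ≤ 1 := by
    have : (1 / 2 : ℝ) ^ k ≤ (1 / 2) ^ 20 := pow_le_pow_of_le_one (by norm_num) (by norm_num) hk
    norm_num at this ⊢
    linarith
  calc (n : ℝ) ^ 2 * (1 / 2) ^ (4 * k) ≤ (4 * 2 ^ k) ^ 2 * (1 / 2) ^ (4 * k) := by gcongr
    _ = 16 * (1 / 2) ^ k * (1 / 2) ^ k := by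
        simp only [half_pow_eq, pow_mul']
        field_simp
        ring
    _ ≤ 1 * (1 / 2) ^ k := by gcongr
    _ = (1 / 2) ^ k := one_mul _

/-! ### The probability of success -/

theorem exists_lastPhase (n : ℕ) : ∃ k, firstPhase ≤ k ∧ 16 * n ≤ 2 ^ k := by
  refine ⟨firstPhase + 16 * n, Nat.le_add_right _ _, ?_⟩
  exact (Nat.lt_two_pow_self.le).trans (Nat.pow_le_pow_right (by norm_num) (Nat.le_add_left _ _))

/-- The phase in which the estimation most likely ends at the latest. -/
def lastPhase (n : ℕ) : ℕ := Nat.find (exists_lastPhase n)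

theorem firstPhase_le_lastPhase (n : ℕ) : firstPhase ≤ lastPhase n :=
  (Nat.find_spec (exists_lastPhase n)).1

theorem le_two_pow_lastPhase (n : ℕ) : 16 * n ≤ 2 ^ lastPhase n :=
  (Nat.find_spec (exists_lastPhase n)).2

theorem lastPhase_eq_or_lt (n : ℕ) : lastPhase n = firstPhase ∨ 2 ^ lastPhase n < 32 * n := by
  by_cases h : lastPhase n = firstPhase
  · exact Or.inl h
  · right
    have h0 := firstPhase_le_lastPhase n
    obtain ⟨k, hk⟩ := Nat.exists_eq_succ_of_ne_zero (show lastPhase n ≠ 0 by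
      rw [firstPhase] at h0; omega)
    have h1 : ¬ (firstPhase ≤ k ∧ 16 * n ≤ 2 ^ k) :=
      Nat.find_min (exists_lastPhase n) (show k < lastPhase n by omega)
    rw [hk, pow_succ]
    omega

/-- The outcomes of the coin flips for which the algorithm works as intended. -/
structure GoodOutcome {n : ℕ} (ω : Fin n → CoinTape) : Prop where
  not_early : ∀ j, firstPhase ≤ j → 4 * 2 ^ j ≤ n → silentCount ω j (8 * j) < 4 * j
  not_late : 4 * lastPhase n ≤ silentCount ω (lastPhase n) (8 * lastPhase n)
  labels : ∀ k, firstPhase ≤ k → k ≤ lastPhase n → n < 4 * 2 ^ k → GoodLabels ω k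

/-- The estimate is the first mostly silent phase: `not_late` bounds it by `lastPhase n`, and
`not_early` read backwards gives `n < 4 * 2 ^ k`. -/
theorem GoodOutcome.exists_exec {n : ℕ} {ω : Fin n → CoinTape} (h : GoodOutcome ω) :
    ∃ k, firstPhase ≤ k ∧ k ≤ lastPhase n ∧
      ∃ t ≤ (k + 1) * (8 * k + 1) + 2 ^ bucketBits k * windowLength k,
        Exec ω t (fun _ => (k + 1) * (8 * k + 1) + 3 * windowLength k)
          (fun _ => NodeState.startPhase firstPhase) (fun _ => NodeState.done n) := by
  have hex : ∃ k, firstPhase ≤ k ∧ 4 * k ≤ silentCount ω k (8 * k) :=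
    ⟨lastPhase n, firstPhase_le_lastPhase n, h.not_late⟩
  obtain ⟨h1, h2⟩ := Nat.find_spec hex
  have h3 : Nat.find hex ≤ lastPhase n :=
    Nat.find_min' hex ⟨firstPhase_le_lastPhase n, h.not_late⟩
  refine ⟨Nat.find hex, h1, h3, exec_algorithm h1 (fun j hj hjk => ?_) h2 (h.labels _ h1 h3 ?_)⟩
  · have := Nat.find_min hex hjk
    rw [not_and, not_le] at this
    exact this hj
  · by_contra hlt
    exact absurd h2 (not_le.2 (h.not_early _ h1 (not_lt.1 hlt)))

/-- Fewer than `n` phases are too early, and each ends the estimation with probability at most `1 /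
n ^ 2`. For `n < 2 ^ 20` there are none. -/
theorem network_early (n : ℕ) :
    (networkMeasure n).real {ω | ∃ j, firstPhase ≤ j ∧ 4 * 2 ^ j ≤ n ∧
      4 * j ≤ silentCount ω j (8 * j)} ≤ 1 / max (n : ℝ) (2 ^ 20) := by
  have hmax : 0 < max (n : ℝ) (2 ^ 20) := lt_max_of_lt_right (by norm_num)
  by_cases hn : 2 ^ 20 ≤ n
  · have hn' : (2 : ℝ) ^ 20 ≤ n := by exact_mod_cast hn
    have h := network_biUnion_le
      (E := {ω : Fin n → CoinTape | ∃ j, firstPhase ≤ j ∧ 4 * 2 ^ j ≤ n ∧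
        4 * j ≤ silentCount ω j (8 * j)})
      ((Finset.range n).filter fun j => firstPhase ≤ j ∧ 4 * 2 ^ j ≤ n)
      (fun j => {ω | 4 * j ≤ silentCount ω j (8 * j)})
      (fun ω ⟨j, h1, h2, h3⟩ => ⟨j, by
        have := Nat.lt_two_pow_self (n := j)
        rw [Finset.mem_filter, Finset.mem_range]
        exact ⟨by omega, h1, h2⟩, h3⟩)
      (p := 1 / (n : ℝ) ^ 2)
      (fun j hj => by
        obtain ⟨-, h1, h2⟩ := Finset.mem_filter.1 hj
        exact (network_many_silent n j).trans
          (many_silent_bound (le_trans (by norm_num [firstPhase]) h1) h2))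
    rw [max_eq_left hn']
    have hn0 : (0 : ℝ) < n := by linarith [show (0 : ℝ) < 2 ^ 20 by norm_num]
    calc _ ≤ _ := h
      _ ≤ (n : ℝ) * (1 / (n : ℝ) ^ 2) := by
          refine mul_le_mul_of_nonneg_right ?_ (by positivity)
          have hc := Finset.card_filter_le (Finset.range n) fun j =>
            firstPhase ≤ j ∧ 4 * 2 ^ j ≤ n
          rw [Finset.card_range] at hc
          exact_mod_cast hc
      _ = 1 / n := by field_simp
  · have hempty : {ω : Fin n → CoinTape | ∃ j, firstPhase ≤ j ∧ 4 * 2 ^ j ≤ n ∧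
        4 * j ≤ silentCount ω j (8 * j)} = ∅ := by
      rw [Set.eq_empty_iff_forall_notMem]
      rintro ω ⟨j, h1, h2, -⟩
      have h3 : 2 ^ 20 ≤ 2 ^ j := Nat.pow_le_pow_right (by norm_num) h1
      omega
    rw [hempty, measureReal_empty]
    positivity

theorem network_late (n : ℕ) :
    (networkMeasure n).real
      {ω | silentCount ω (lastPhase n) (8 * lastPhase n) < 4 * lastPhase n} ≤
        1 / max (n : ℝ) (2 ^ 20) := by
  refine (network_many_busy n _).trans ((many_busy_bound (le_two_pow_lastPhase n)).trans ?_)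
  rw [half_pow_eq]
  refine one_div_le_one_div_of_le (lt_max_of_lt_right (by norm_num)) (max_le ?_ ?_)
  · have h : n ≤ 2 ^ lastPhase n := by linarith [le_two_pow_lastPhase n]
    exact_mod_cast h
  · exact pow_le_pow_right₀ (by norm_num) (firstPhase_le_lastPhase n)

theorem network_bad_labels {n k : ℕ} (hn : 1 ≤ n) (hk : 20 ≤ k) (h : n < 4 * 2 ^ k)
    (h' : k = 20 ∨ 2 ^ k ≤ 32 * n) :
    (networkMeasure n).real {ω | ¬ GoodLabels ω k} ≤ 3 * (1 / 2) ^ k := by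
  have hsub : {ω : Fin n → CoinTape | ¬ GoodLabels ω k} ⊆
      ({ω | ∃ w < 2 ^ bucketBits k, members ω k w = ∅} ∪
        {ω | ∃ w < 2 ^ bucketBits k, maxLoad k < (members ω k w).card}) ∪
        {ω | ¬ Function.Injective fun v => ident k (ω v)} := by
    intro ω hω
    by_contra hc
    simp only [Set.mem_union, Set.mem_ofPred_eq, not_or, not_exists, not_and, not_not,
      not_lt] at hc
    refine hω ⟨?_, hc.2, fun w hw => Finset.nonempty_iff_ne_empty.2 (hc.1.1 w hw), hc.1.2⟩
    rw [sizeBits, pow_add]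
    omega
  refine (measureReal_mono hsub (measure_ne_top _ _)).trans ((measureReal_union_le _ _).trans ?_)
  have h1 := (network_empty_bucket n k).trans (empty_bucket_bound hk hn h')
  have h2 := (network_heavy_bucket n k (maxLoad k)).trans (heavy_bucket_bound hk h)
  have h3 := (network_ident_collision n k).trans (ident_collision_bound hk h)
  have h4 := measureReal_union_le (μ := networkMeasure n)
    {ω | ∃ w < 2 ^ bucketBits k, members ω k w = ∅}
    {ω | ∃ w < 2 ^ bucketBits k, maxLoad k < (members ω k w).card}
  linarith

/-- The estimate is random and may depend on the bits that make the labels, so all its possible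
values are covered by a union bound; there are at most seven. -/
theorem network_some_bad_labels {n : ℕ} (hn : 1 ≤ n) :
    (networkMeasure n).real {ω | ∃ k, firstPhase ≤ k ∧ k ≤ lastPhase n ∧ n < 4 * 2 ^ k ∧
      ¬ GoodLabels ω k} ≤ 84 / max (n : ℝ) (2 ^ 20) := by
  have hmax : 0 < max (n : ℝ) (2 ^ 20) := lt_max_of_lt_right (by norm_num)
  have hlast := lastPhase_eq_or_lt n
  rw [firstPhase] at *
  set s := (Finset.Icc 20 (lastPhase n)).filter fun k => n < 4 * 2 ^ k with hs
  have hcard : s.card ≤ 7 := by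
    have hsub : s ⊆ Finset.Icc (lastPhase n - 6) (lastPhase n) := by
      intro k hk
      rw [hs, Finset.mem_filter, Finset.mem_Icc] at hk
      rw [Finset.mem_Icc]
      refine ⟨?_, hk.1.2⟩
      rcases hlast with h | h
      · omega
      -- `2 ^ lastPhase n < 32 * n` and `n < 4 * 2 ^ k`, whence the factor `2 ^ 7`.
      · have h1 : 2 ^ lastPhase n < 2 ^ (k + 7) := by
          rw [pow_add]
          omega
        have := (Nat.pow_lt_pow_iff_right (by norm_num)).1 h1
        omega
    refine (Finset.card_le_card hsub).trans ?_
    rw [Nat.card_Icc]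
    omega
  have h := network_biUnion_le
    (E := {ω : Fin n → CoinTape | ∃ k, 20 ≤ k ∧ k ≤ lastPhase n ∧ n < 4 * 2 ^ k ∧
      ¬ GoodLabels ω k}) s
    (fun k => {ω | ¬ GoodLabels ω k})
    (fun ω ⟨k, h1, h2, h3, h4⟩ =>
      ⟨k, Finset.mem_filter.2 ⟨Finset.mem_Icc.2 ⟨h1, h2⟩, h3⟩, h4⟩)
    -- `12 = 3 * 4`: three kinds of bad labels, and `2 ^ (-k)` is at most `4 / max n (2 ^ 20)`.
    (p := 12 / max (n : ℝ) (2 ^ 20))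
    (fun k hk => by
      rw [hs, Finset.mem_filter, Finset.mem_Icc] at hk
      obtain ⟨⟨h1, h2⟩, h3⟩ := hk
      refine (network_bad_labels hn h1 h3 ?_).trans ?_
      · rcases hlast with h | h
        · exact Or.inl (by omega)
        · exact Or.inr ((Nat.pow_le_pow_right (by norm_num) h2).trans h.le)
      · rw [half_pow_eq, mul_one_div, div_le_div_iff₀ (by positivity) hmax]
        have h4 : max (n : ℝ) (2 ^ 20) ≤ 4 * 2 ^ k := by
          refine max_le (by exact_mod_cast h3.le) ?_
          have : (2 : ℝ) ^ 20 ≤ 2 ^ k := pow_le_pow_right₀ (by norm_num) h1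
          linarith [show (0 : ℝ) < 2 ^ k by positivity]
        linarith)
  refine h.trans ?_
  have hc : (s.card : ℝ) ≤ 7 := by exact_mod_cast hcard
  calc (s.card : ℝ) * (12 / max (n : ℝ) (2 ^ 20)) ≤ 7 * (12 / max (n : ℝ) (2 ^ 20)) := by gcongr
    _ = 84 / max (n : ℝ) (2 ^ 20) := by ring

theorem network_not_goodOutcome {n : ℕ} (hn : 1 ≤ n) :
    (networkMeasure n).real {ω | ¬ GoodOutcome ω} ≤ 1 / (n : ℝ) ^ (1 / 2 : ℝ) := by
  have hsub : {ω : Fin n → CoinTape | ¬ GoodOutcome ω} ⊆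
      ({ω | ∃ j, firstPhase ≤ j ∧ 4 * 2 ^ j ≤ n ∧ 4 * j ≤ silentCount ω j (8 * j)} ∪
        {ω | silentCount ω (lastPhase n) (8 * lastPhase n) < 4 * lastPhase n}) ∪
        {ω | ∃ k, firstPhase ≤ k ∧ k ≤ lastPhase n ∧ n < 4 * 2 ^ k ∧ ¬ GoodLabels ω k} := by
    intro ω hω
    by_contra hc
    simp only [Set.mem_union, Set.mem_ofPred_eq, not_or, not_exists, not_and, not_not,
      not_lt, not_le] at hc
    exact hω ⟨hc.1.1, hc.1.2, hc.2⟩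
  have h1 := (measureReal_mono hsub (measure_ne_top (networkMeasure n) _)).trans
    (measureReal_union_le _ _)
  have h2 := measureReal_union_le (μ := networkMeasure n)
    {ω | ∃ j, firstPhase ≤ j ∧ 4 * 2 ^ j ≤ n ∧ 4 * j ≤ silentCount ω j (8 * j)}
    {ω | silentCount ω (lastPhase n) (8 * lastPhase n) < 4 * lastPhase n}
  have h3 := network_early n
  have h4 := network_late n
  have h5 := network_some_bad_labels hn
  set N : ℝ := max (n : ℝ) (2 ^ 20) with hN
  have hN20 : (2 : ℝ) ^ 20 ≤ N := le_max_right _ _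
  have hNn : (n : ℝ) ≤ N := le_max_left _ _
  have hn0 : (0 : ℝ) < n := by exact_mod_cast hn
  have hs : (1024 : ℝ) ≤ √N := Real.le_sqrt_of_sq_le (by norm_num at hN20 ⊢; linarith)
  have hsq : √N * √N = N := Real.mul_self_sqrt (by linarith)
  -- The total failure constant `1 + 1 + 84` is below `1024 ≤ √N`; half of the exponent is given up
  -- to absorb it.
  have h6 : 86 / N ≤ 1 / √N := by
    rw [div_le_div_iff₀ (by linarith) (by linarith)]
    nlinarith
  have h7 : 1 / √N ≤ 1 / (n : ℝ) ^ (1 / 2 : ℝ) := by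
    rw [← Real.sqrt_eq_rpow]
    exact one_div_le_one_div_of_le (Real.sqrt_pos.2 hn0) (Real.sqrt_le_sqrt hNn)
  have h8 : 86 / N = 1 / N + 1 / N + 84 / N := by ring
  linarith

/-! ### Time and energy -/

theorem windowLength_le {k : ℕ} (hk : 1 ≤ k) : windowLength k ≤ 2 ^ 25 * k ^ 2 := by
  rw [windowLength, maxLoad, idBits, sizeBits]
  nlinarith

theorem energy_bound {k : ℕ} (hk : 1 ≤ k) :
    (k + 1) * (8 * k + 1) + 3 * windowLength k ≤ 2 ^ 27 * k ^ 2 := by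
  have := windowLength_le hk
  nlinarith

theorem time_bound {k : ℕ} (hk : 20 ≤ k) :
    (k + 1) * (8 * k + 1) + 2 ^ bucketBits k * windowLength k ≤ 2 ^ 26 * k * 2 ^ k := by
  have h1 := windowLength_le (k := k) (by omega)
  -- The number of buckets is at most `2 ^ k / k`, which cancels one of the two factors `k` in the
  -- length of a window.
  have h2 : 2 ^ bucketBits k * k ≤ 2 ^ k := by
    rw [← two_pow_bucketBits_mul hk]
    refine Nat.mul_le_mul_left _ ?_
    have := Nat.lt_pow_succ_log_self (b := 2) (by norm_num) k
    rw [pow_succ] at this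
    omega
  have h3 : k < 2 ^ k := Nat.lt_two_pow_self
  calc (k + 1) * (8 * k + 1) + 2 ^ bucketBits k * windowLength k
      ≤ 18 * k * k + 2 ^ bucketBits k * (2 ^ 25 * k ^ 2) := by
        refine Nat.add_le_add ?_ (Nat.mul_le_mul_left _ h1)
        nlinarith
    _ = 18 * k * k + 2 ^ 25 * k * (2 ^ bucketBits k * k) := by ring
    _ ≤ 18 * k * 2 ^ k + 2 ^ 25 * k * 2 ^ k := by gcongr
    _ ≤ 2 ^ 26 * k * 2 ^ k := by
        rw [← Nat.add_mul, ← Nat.add_mul]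
        gcongr
        norm_num

theorem two_pow_lastPhase_le {n : ℕ} (hn : 1 ≤ n) : 2 ^ lastPhase n ≤ 2 ^ 20 * n := by
  rcases lastPhase_eq_or_lt n with h | h
  · rw [h, firstPhase]
    omega
  · omega

theorem lastPhase_le_log {n : ℕ} (hn : 2 ≤ n) : (lastPhase n : ℝ) ≤ 42 * Real.log n := by
  have h : (2 : ℝ) ^ lastPhase n ≤ 2 ^ 20 * n := by
    exact_mod_cast two_pow_lastPhase_le (by omega : 1 ≤ n)
  have hn' : (2 : ℝ) ≤ n := by exact_mod_cast hn
  have h1 := Real.log_le_log (by positivity) h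
  rw [Real.log_mul (by positivity) (by positivity), Real.log_pow, Real.log_pow] at h1
  have h2 := Real.log_le_log (by norm_num) hn'
  have h3 := Real.log_two_gt_d9
  push_cast at h1
  have h4 : (0 : ℝ) ≤ lastPhase n := Nat.cast_nonneg _
  -- `lastPhase n * log 2 ≤ 20 * log 2 + log n ≤ 21 * log n`, and `log 2 > 1 / 2` doubles the
  -- constant to `42`.
  nlinarith

theorem GoodOutcome.countsWithin {n : ℕ} (hn : 2 ≤ n) {ω : Fin n → CoinTape}
    (h : GoodOutcome ω) :
    algorithm.CountsWithin ω (2 ^ 46 * 42 * ((n : ℝ) * Real.log n))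
      (2 ^ 27 * 42 ^ 2 * Real.log n ^ 2) := by
  obtain ⟨k, hk, hkl, t, ht, hexec⟩ := h.exists_exec
  have hklog : (k : ℝ) ≤ 42 * Real.log n :=
    le_trans (by exact_mod_cast hkl) (lastPhase_le_log hn)
  have hpow : (2 : ℝ) ^ k ≤ 2 ^ 20 * n := by
    have h1 : 2 ^ k ≤ 2 ^ 20 * n :=
      (Nat.pow_le_pow_right (by norm_num) hkl).trans (two_pow_lastPhase_le (by omega))
    exact_mod_cast h1
  refine hexec.countsWithin ?_ ?_
  · have h1 : (t : ℝ) ≤ 2 ^ 26 * k * 2 ^ k := by exact_mod_cast ht.trans (time_bound hk)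
    calc (t : ℝ) ≤ 2 ^ 26 * k * 2 ^ k := h1
      _ ≤ 2 ^ 26 * (42 * Real.log n) * (2 ^ 20 * n) := by gcongr
      _ = 2 ^ 46 * 42 * ((n : ℝ) * Real.log n) := by ring
  · have h1 := energy_bound (k := k) (le_trans (by norm_num [firstPhase]) hk)
    calc (((k + 1) * (8 * k + 1) + 3 * windowLength k : ℕ) : ℝ) ≤ 2 ^ 27 * (k : ℝ) ^ 2 := by
          exact_mod_cast h1
      _ ≤ 2 ^ 27 * (42 * Real.log n) ^ 2 := by gcongr
      _ = 2 ^ 27 * 42 ^ 2 * Real.log n ^ 2 := by ring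

end Counting

/-! ### The main theorem -/

theorem mainTheorem2 :
    ∃ (A : BeepAlgorithm) (c K L : ℝ), 0 < c ∧ 0 < K ∧ 0 < L ∧
      ∀ n : ℕ, 1 ≤ n →
        1 - 1 / (n : ℝ) ^ c ≤
          (networkMeasure n).real
            {ω : Fin n → CoinTape |
              A.CountsWithin ω (K * ((n : ℝ) * Real.log n)) (L * Real.log n ^ 2)} := by
  refine ⟨Counting.algorithm, 1 / 2, 2 ^ 46 * 42, 2 ^ 27 * 42 ^ 2, by norm_num, by norm_num,
    by norm_num, fun n hn => ?_⟩
  -- For `n = 1` the time and energy budgets vanish, but so does the required probability.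
  rcases hn.eq_or_lt with rfl | hn2
  · rw [Nat.cast_one, Real.one_rpow, div_one, sub_self]
    exact measureReal_nonneg
  have h1 := Counting.network_not_goodOutcome hn
  -- Subadditivity suffices to pass to the complement, so measurability of the good event is not
  -- needed.
  have h2 := measureReal_union_le (μ := networkMeasure n)
    {ω | Counting.GoodOutcome ω} {ω | ¬ Counting.GoodOutcome ω}
  have h3 : {ω : Fin n → CoinTape | Counting.GoodOutcome ω} ∪ {ω | ¬ Counting.GoodOutcome ω} =
      Set.univ := by
    ext ω
    simp [em]
  rw [h3, probReal_univ] at h2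
  have h4 := measureReal_mono (μ := networkMeasure n)
    (show {ω : Fin n → CoinTape | Counting.GoodOutcome ω} ⊆ {ω | Counting.algorithm.CountsWithin ω
      (2 ^ 46 * 42 * ((n : ℝ) * Real.log n)) (2 ^ 27 * 42 ^ 2 * Real.log n ^ 2)} from
      fun ω hω => Counting.GoodOutcome.countsWithin hn2 hω) (measure_ne_top _ _)
  exact (sub_le_sub_left h1 1).trans ((sub_le_iff_le_add.2 h2).trans h4)
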